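/- **Setting.** Let $(M,d)$ be a locally compact separable metric space and $\mu$ a Radon measure on $M$ with full support; write $B(x,r)$ for the open ball and $V(x,r)=\mu(B(x,r))$. A family of non-decreasing functions $\Psi_x:(0,\infty)\to(0,\infty)$ satisfies the weak scaling property uniformly with $(a_1,a_2)$, where $0<a_1\le a_2<\infty$, if there are constants $c_1,c_2>0$, independent of $x$, such that $c_1(R/r)^{a_1}\le \Psi_x(R)/\Psi_x(r)\le c_2(R/r)^{a_2}$ for all $0<r\le R$. Assume that $\{V(x,\cdot)\}_{x\in M}$ satisfies it uniformly with $(d_1,d_2)$. Let $S=(S_t)_{t\ge0}$ be a subordinator (a non-decreasing real-valued Lévy process with $S_0=0$) without drift, with Laplace exponent $\phi$, i.e. $\mathbb E e^{-\lambda S_t}=e^{-t\phi(\lambda)}$ and $\phi(\lambda)=\int_0^\infty(1-e^{-\lambda s})\,\nu(ds)$ with $\int_0^\infty (1\wedge s)\,\nu(ds)<\infty$, and assume that $\phi$ satisfies the weak scaling property with $(\beta_1,\beta_2)$, where $0<\beta_1\le\beta_2<1$. Let $X$ be a strong Markov process on $M$ with infinite lifetime which has a transition density function $q(t,x,y)$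 with respect to $\mu$, and let $$p(t,x,y)=\int_0^\infty q(r,x,y)\,d_r\mathbb P(S_r\ge t)\in[0,\infty],\qquad t>0,\ x,y\in M .$$ Let $\Phi:[0,\infty)\to[0,\infty)$ be strictly increasing with $\Phi(0)=0$ and with the weak scaling property with $(\alpha_1,\alpha_2)$, and let $\Phi^{-1}(s)=\inf\{r\ge0:\Phi(r)\ge s\}$. Assume that one of the following two conditions holds. * (Jump case) There are constants $c_1,c_2>0$ such that for all $t>0$ and $x,y\in M$ $$c_1 J\le q(t,x,y)\le c_2 J,\qquad J=\frac1{V(x,\Phi^{-1}(t))}\wedge\frac{t}{V(x,d(x,y))\,\Phi(d(x,y))},$$ where the second term of the minimum is $+\infty$ if $x=y$. * (Diffusion case) $M$ is connected and satisfies the chain condition (there is $C>0$ such that for all $x,y\in M$ and $n\ge1$ there are $x=x_0,x_1,\dots,x_n=y$ in $M$ with $d(x_i,x_{i+1})\le C\,d(x,y)/n$ for all $i<n$), $X$ has continuous paths, $\alpha_1>1$, and there are constants $c_1,c_2,c_3,c_4>0$ such that for all $t>0$ and $x,y\in M$ $$\frac{c_1}{V(x,\Phi^{-1}(t))}e^{-c_2m(t,d(x,y))}\le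 q(t,x,y)\le \frac{c_3}{V(x,\Phi^{-1}(t))}e^{-c_4m(t,d(x,y))},$$ where $m(t,r)>0$ for $t,r>0$, $m(\cdot,r)$ is non-increasing for each $r>0$, there are constants $c_5,c_6>0$ with $c_5\,\Phi(r/m(t,r))\le t/m(t,r)\le c_6\,\Phi(r/m(t,r))$ for all $t,r>0$, and $m(t,0)=0$. **Conclusion.** Below, $p\simeq f$ on a set of triples $(t,x,y)$ means that there are constants $C_1,C_2>0$, independent of $(t,x,y)$, with $C_1f\le p\le C_2f$ on that set. 1. If $d_2<\alpha_1$, then for all $t>0$ and $x,y\in M$ with $\Phi(d(x,y))\phi(t^{-1})\le1$, $$p(t,x,y)\simeq\frac1{V(x,\Phi^{-1}(1/\phi(t^{-1})))}.$$ 2. If $d_1>\alpha_2$, then for all $t>0$ and $x\ne y$ with $\Phi(d(x,y))\phi(t^{-1})\le1$, $$p(t,x,y)\simeq\frac{\Phi(d(x,y))\,\phi(t^{-1})}{V(x,d(x,y))},$$ and $p(t,x,x)=\infty$ for all $t>0$, $x\in M$. 3. If $d_1=d_2=\alpha_1=\alpha_2$, then for all $t>0$ and $x\ne y$ with $\Phi(d(x,y))\phi(t^{-1})\le1$,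 $$p(t,x,y)\simeq\frac1{V(x,\Phi^{-1}(1/\phi(t^{-1})))}\,\log\Big(\frac{2}{\Phi(d(x,y))\,\phi(t^{-1})}\Big),$$ and $p(t,x,x)=\infty$ for all $t>0$, $x\in M$. -/

import Mathlib

open MeasureTheory ProbabilityTheory Set
open scoped NNReal ENNReal

noncomputable section

namespace TimeFractional

/-! ### Weak scaling, volume function, generalized inverse, chain condition -/

/-- A family of non-decreasing functions `Ψ x : (0,∞) → (0,∞)` satisfies the weak scaling property
with exponents `0 < a₁ ≤ a₂`, with constants independent of the member `x` of the family. -/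
structure WeakScalingUniformly {Λ : Type*} (Ψ : Λ → ℝ → ℝ) (a₁ a₂ : ℝ) : Prop where
  pos_left : 0 < a₁
  left_le_right : a₁ ≤ a₂
  pos : ∀ x r, 0 < r → 0 < Ψ x r
  mono : ∀ x, MonotoneOn (Ψ x) (Ioi 0)
  scaling : ∃ c₁ c₂ : ℝ, 0 < c₁ ∧ 0 < c₂ ∧ ∀ x r R, 0 < r → r ≤ R →
    c₁ * (R / r) ^ a₁ ≤ Ψ x R / Ψ x r ∧ Ψ x R / Ψ x r ≤ c₂ * (R / r) ^ a₂

/-- The weak scaling property of a single function. -/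
def WeakScaling (Ψ : ℝ → ℝ) (a₁ a₂ : ℝ) : Prop :=
  WeakScalingUniformly (fun _ : Unit => Ψ) a₁ a₂

/-- The volume `V(x, r) = μ(B(x, r))` of the open ball. -/
def vol {M : Type*} [MetricSpace M] [MeasurableSpace M] (μ : Measure M) (x : M) (r : ℝ) : ℝ :=
  μ.real (Metric.ball x r)

/-- The inverse `Φ⁻¹(s) = inf {r ≥ 0 : Φ(r) ≥ s}` of an increasing function on `[0,∞)`. It is the
ordinary inverse when `Φ` is a strictly increasing bijection of `[0,∞)`, and it also makes sense
when `Φ` jumps. -/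
def inv (Φ : ℝ → ℝ) (s : ℝ) : ℝ := sInf {r : ℝ | 0 ≤ r ∧ s ≤ Φ r}

/-- The chain condition for a metric space. -/
def ChainCondition (M : Type*) [MetricSpace M] : Prop :=
  ∃ C : ℝ, 0 < C ∧ ∀ (x y : M) (n : ℕ), 1 ≤ n → ∃ z : ℕ → M, z 0 = x ∧ z n = y ∧
    ∀ i < n, dist (z i) (z (i + 1)) ≤ C * (dist x y / n)

/-! ### Subordinators and their Laplace exponents -/

/-- `S` is a subordinator: a non-decreasing real-valued Lévy process started at `0`. -/
structure IsSubordinator {Ω : Type*} [MeasurableSpace Ω] (P : Measure Ω) (S : ℝ≥0 → Ω → ℝ) :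
    Prop where
  measurable : ∀ t, Measurable (S t)
  zero : ∀ᵐ ω ∂P, S 0 ω = 0
  mono : ∀ᵐ ω ∂P, Monotone fun t => S t ω
  rightCont : ∀ᵐ ω ∂P, ∀ t, ContinuousWithinAt (fun s => S s ω) (Ici t) t
  indep : HasIndepIncrements S P
  stationary : ∀ s t, IdentDistrib (fun ω => S (s + t) ω - S s ω) (S t) P P

/-- `φ` is the Laplace exponent of `S`, `E exp(-l S_t) = exp(-t φ(l))`, and `S` has no drift:
`φ(l) = ∫ (1 - exp(-l s)) ν(ds)` for a Lévy measure `ν` on `(0,∞)`. -/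
structure IsDriftlessLaplaceExponent {Ω : Type*} [MeasurableSpace Ω] (P : Measure Ω)
    (S : ℝ≥0 → Ω → ℝ) (φ : ℝ → ℝ) : Prop where
  laplace : ∀ (t : ℝ≥0) (l : ℝ), 0 < t → 0 < l →
    ∫ ω, Real.exp (-l * S t ω) ∂P = Real.exp (-(t : ℝ) * φ l)
  driftless : ∃ ν : Measure ℝ, ν (Iic 0) = 0 ∧ ∫⁻ s, ENNReal.ofReal (min 1 s) ∂ν < ∞ ∧
    ∀ l : ℝ, 0 < l → φ l = ∫ s, (1 - Real.exp (-l * s)) ∂ν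

/-- The function `r ↦ P(S_r ≥ t)` for `r ≥ 0`, extended by its value at `0` to `r < 0`. -/
def tail {Ω : Type*} [MeasurableSpace Ω] (P : Measure Ω) (S : ℝ≥0 → Ω → ℝ) (t r : ℝ) : ℝ :=
  P.real {ω | t ≤ S r.toNNReal ω}

theorem IsSubordinator.monotone_tail {Ω : Type*} [MeasurableSpace Ω] {P : Measure Ω}
    [IsProbabilityMeasure P] {S : ℝ≥0 → Ω → ℝ} (hS : IsSubordinator P S) (t : ℝ) :
    Monotone (tail P S t) := by
  intro a b hab
  refine ENNReal.toReal_mono (measure_ne_top _ _) (measure_mono_ae ?_)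
  filter_upwards [hS.mono] with ω hω h
  exact le_trans (show t ≤ S a.toNNReal ω from h) (hω (Real.toNNReal_mono hab))

/-- The fundamental solution `p(t, x, y) = ∫₀^∞ q(r, x, y) d_r P(S_r ≥ t)`, an integral with respect
to the Lebesgue–Stieltjes measure of `r ↦ P(S_r ≥ t)`, with values in `[0, ∞]`. -/
def fundamentalSolution {Ω : Type*} [MeasurableSpace Ω] {P : Measure Ω} [IsProbabilityMeasure P]
    {S : ℝ≥0 → Ω → ℝ} (hS : IsSubordinator P S) {M : Type*} (q : ℝ → M → M → ℝ)
    (t : ℝ) (x y : M) : ℝ≥0∞ :=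
  ∫⁻ r in Ioi 0, ENNReal.ofReal (q r x y) ∂(hS.monotone_tail t).stieltjesFunction.measure

/-! ### Strong Markov processes and heat kernels -/

/-- `X`, with laws `Q x` (`x ∈ M`) on `Ω`, is a strong Markov process with respect to `ℱ`, with
state space `M` and infinite lifetime: for every stopping time `τ`, every `A ∈ ℱ_τ`, every `s ≥ 0`
and every Borel set `B`,
`Q x (A, τ < ∞, X_{τ+s} ∈ B) = ∫_{A ∩ {τ < ∞}} Q (X_τ) (X_s ∈ B) dQ x`. -/
structure IsStrongMarkovProcess {M : Type*} [MetricSpace M] [MeasurableSpace M]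
    {Ω : Type*} {mΩ : MeasurableSpace Ω} (ℱ : Filtration ℝ≥0 mΩ) (Q : M → Measure Ω)
    (X : ℝ≥0 → Ω → M) : Prop where
  isProbabilityMeasure : ∀ x, IsProbabilityMeasure (Q x)
  progressive : IsStronglyProgressive ℱ X
  start : ∀ x, ∀ᵐ ω ∂Q x, X 0 ω = x
  measurable_law : ∀ (s : ℝ≥0) (B : Set M), MeasurableSet B →
    Measurable fun x => Q x {ω | X s ω ∈ B}
  strongMarkov : ∀ (x : M) (τ : Ω → WithTop ℝ≥0) (hτ : IsStoppingTime ℱ τ) (A : Set Ω),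
    MeasurableSet[hτ.measurableSpace] A → ∀ (s : ℝ≥0) (B : Set M), MeasurableSet B →
    Q x {ω | ω ∈ A ∧ τ ω ≠ ⊤ ∧ X ((τ ω).untopD 0 + s) ω ∈ B} =
      ∫⁻ ω in {ω | ω ∈ A ∧ τ ω ≠ ⊤}, Q (X ((τ ω).untopD 0) ω) {ω' | X s ω' ∈ B} ∂Q x

/-- `q(t, x, y)`, `t > 0`, is a transition density function (heat kernel) of `X` with respect to
`μ`. -/
structure IsHeatKernel {M : Type*} [MeasurableSpace M] {Ω : Type*} [MeasurableSpace Ω]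
    (μ : Measure M) (Q : M → Measure Ω) (X : ℝ≥0 → Ω → M) (q : ℝ → M → M → ℝ) : Prop where
  measurable : Measurable fun z : Ioi (0 : ℝ) × M × M => q z.1 z.2.1 z.2.2
  nonneg : ∀ t x y, 0 < t → 0 ≤ q t x y
  density : ∀ (t : ℝ≥0) (x : M) (B : Set M), 0 < t → MeasurableSet B →
    Q x {ω | X t ω ∈ B} = ∫⁻ y in B, ENNReal.ofReal (q t x y) ∂μ

/-! ### The two heat kernel conditions -/

/-- `1 / V(x, Φ⁻¹(t)) ∧ t / (V(x, d(x,y)) Φ(d(x,y)))`; the second term is `+∞` when `x = y`. -/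
def jumpProfile {M : Type*} [MetricSpace M] [MeasurableSpace M] (μ : Measure M) (Φ : ℝ → ℝ)
    (t : ℝ) (x y : M) : ℝ :=
  if dist x y = 0 then 1 / vol μ x (inv Φ t)
  else min (1 / vol μ x (inv Φ t)) (t / (vol μ x (dist x y) * Φ (dist x y)))

/-- Two-sided heat kernel estimates in the pure jump case. -/
def JumpEstimate {M : Type*} [MetricSpace M] [MeasurableSpace M] (μ : Measure M) (Φ : ℝ → ℝ)
    (q : ℝ → M → M → ℝ) : Prop :=
  ∃ c₁ c₂ : ℝ, 0 < c₁ ∧ 0 < c₂ ∧ ∀ (t : ℝ) (x y : M), 0 < t →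
    c₁ * jumpProfile μ Φ t x y ≤ q t x y ∧ q t x y ≤ c₂ * jumpProfile μ Φ t x y

/-- `m(t, r)` is strictly positive for `t, r > 0`, non-increasing in `t`, and determined up to
constants by `t / m(t,r) ≃ Φ(r / m(t,r))`; moreover `m(t, 0) = 0`. -/
structure IsStepFunction (Φ : ℝ → ℝ) (m : ℝ → ℝ → ℝ) : Prop where
  pos : ∀ t r, 0 < t → 0 < r → 0 < m t r
  antitone : ∀ r, 0 < r → AntitoneOn (fun t => m t r) (Ioi 0)
  scale : ∃ c₁ c₂ : ℝ, 0 < c₁ ∧ 0 < c₂ ∧ ∀ t r, 0 < t → 0 < r →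
    c₁ * Φ (r / m t r) ≤ t / m t r ∧ t / m t r ≤ c₂ * Φ (r / m t r)
  zero : ∀ t, 0 < t → m t 0 = 0

/-- Two-sided heat kernel estimates in the diffusion case. -/
def DiffusionEstimate {M : Type*} [MetricSpace M] [MeasurableSpace M] (μ : Measure M) (Φ : ℝ → ℝ)
    (q : ℝ → M → M → ℝ) : Prop :=
  ∃ m : ℝ → ℝ → ℝ, IsStepFunction Φ m ∧ ∃ c₁ c₂ c₃ c₄ : ℝ,
    0 < c₁ ∧ 0 < c₂ ∧ 0 < c₃ ∧ 0 < c₄ ∧ ∀ (t : ℝ) (x y : M), 0 < t →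
    c₁ / vol μ x (inv Φ t) * Real.exp (-c₂ * m t (dist x y)) ≤ q t x y ∧
    q t x y ≤ c₃ / vol μ x (inv Φ t) * Real.exp (-c₄ * m t (dist x y))

/-- The diffusion case: the space is connected and satisfies the chain condition, the lower scaling
exponent of `Φ` exceeds `1`, `X` has continuous paths, and the heat kernel satisfies the diffusion
estimates. -/
structure DiffusionCase {M : Type*} [MetricSpace M] [MeasurableSpace M] {Ω : Type*}
    [MeasurableSpace Ω] (μ : Measure M) (Q : M → Measure Ω) (X : ℝ≥0 → Ω → M) (Φ : ℝ → ℝ)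
    (α₁ : ℝ) (q : ℝ → M → M → ℝ) : Prop where
  connected : ConnectedSpace M
  chain : ChainCondition M
  one_lt : 1 < α₁
  continuous_paths : ∀ x, ∀ᵐ ω ∂Q x, Continuous fun t => X t ω
  estimate : DiffusionEstimate μ Φ q

/-- Two-sided comparison `p ≃ f` on the set of triples `(t, x, y)` satisfying `D`, with constants
independent of `(t, x, y)`. -/
def Comparable {M : Type*} (D : ℝ → M → M → Prop) (p : ℝ → M → M → ℝ≥0∞) (f : ℝ → M → M → ℝ) :
    Prop :=
  ∃ c₁ c₂ : ℝ, 0 < c₁ ∧ 0 < c₂ ∧ ∀ (t : ℝ) (x y : M), D t x y →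
    ENNReal.ofReal (c₁ * f t x y) ≤ p t x y ∧ p t x y ≤ ENNReal.ofReal (c₂ * f t x y)

end TimeFractional

end

/-! Fix `t` and `x`, put `u = φ(1/t)`, `a = Φ(d(x,y))` and `W(r) = V(x, Φ⁻¹(r))`, and let `ν` be the
Stieltjes measure of `r ↦ P(S_r ≥ t)`. Up to constants `ν` behaves on `(0, 1/u]` like `u dr`: `ν(0,
r] ≲ r u` (`stieltjes_tail_Ioc_le`), the total mass is at most `1` (`stieltjes_tail_Ioi_le`), and
`ν(r, L r] ≳ r u` whenever `r u ≤ 1` (`exists_le_stieltjes_tail_Ioc`). These facts come from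
comparing indicators of `S_r ≥ t` with exponentials of `S_r`; the lower bound on blocks is the
delicate one and rests on `β₂ < 1`.

Both heat kernel conditions reduce to `KernelBounds`: `q(r) ≲ 1/W(r)` always, `q(r) ≲ 1/W(a)` for `r
≤ a`, and `q(r) ≳ 1/W(r)` for `r ≥ a`. Hence `p` is of the order of `a u / W(a) + ∫ u dr / W(r)`
over `a < r < 1/u`, with at most `1/W(1/u)` added from `r > 1/u`.

`W` has scaling exponents `d₁/α₂` and `d₂/α₁`, so the three cases are `W` sublinear, superlinear and
linear. Over geometric scales the sum is dominated by the top scale `1/u`, dominated by the bottom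
scale `a`, or has comparable terms whose number is logarithmic (`lintegral_le_of_sublinear`,
`lintegral_le_of_superlinear`, `lintegral_le_of_linear`; from below `ofReal_le_lintegral`,
`ofReal_log_le_lintegral`). On the diagonal the lower bounds hold for every small scale `a`, and
letting `a → 0` gives `∞` in the last two cases. -/

namespace TimeFractional

/-! ### Tail estimates for the subordinator and its Stieltjes measure. -/

section Subordinator

variable {Ω : Type*} [MeasurableSpace Ω] {P : Measure Ω} {S : ℝ≥0 → Ω → ℝ} {φ : ℝ → ℝ} {β₁ β₂ : ℝ}

theorem IsSubordinator.measurableSet_tail (hS : IsSubordinator P S) (t r : ℝ) :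
    MeasurableSet {ω | t ≤ S r.toNNReal ω} :=
  measurableSet_le measurable_const (hS.measurable _)

theorem tail_nonneg (t r : ℝ) : 0 ≤ tail P S t r := measureReal_nonneg

theorem IsSubordinator.nonneg_ae (hS : IsSubordinator P S) (r : ℝ≥0) : ∀ᵐ ω ∂P, 0 ≤ S r ω := by
  filter_upwards [hS.zero, hS.mono] with ω h0 h
  rw [← h0]
  exact h zero_le

theorem IsSubordinator.tail_eq_integral (hS : IsSubordinator P S) (t r : ℝ) :
    tail P S t r = ∫ ω, {ω | t ≤ S r.toNNReal ω}.indicator (fun _ => (1 : ℝ)) ω ∂P := by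
  rw [integral_indicator_const _ (hS.measurableSet_tail t r), smul_eq_mul, mul_one, tail]

variable [IsProbabilityMeasure P]

theorem IsSubordinator.integrable_exp (hS : IsSubordinator P S) (r : ℝ≥0) {l : ℝ} (hl : 0 < l) :
    Integrable (fun ω => Real.exp (-l * S r ω)) P := by
  refine Integrable.of_bound (C := 1)
    ((hS.measurable r).const_mul (-l)).exp.aestronglyMeasurable ?_
  filter_upwards [hS.nonneg_ae r] with ω h
  rw [Real.norm_eq_abs, Real.abs_exp, Real.exp_le_one_iff]
  nlinarith

theorem IsSubordinator.integrable_one_sub_exp (hS : IsSubordinator P S) (r : ℝ≥0) {l : ℝ}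
    (hl : 0 < l) : Integrable (fun ω => 1 - Real.exp (-l * S r ω)) P :=
  (integrable_const _).sub (hS.integrable_exp r hl)

theorem IsDriftlessLaplaceExponent.integral_one_sub_exp (hφ : IsDriftlessLaplaceExponent P S φ)
    (hS : IsSubordinator P S) {r l : ℝ} (hr : 0 < r) (hl : 0 < l) :
    ∫ ω, (1 - Real.exp (-l * S r.toNNReal ω)) ∂P = 1 - Real.exp (-r * φ l) := by
  rw [integral_sub (integrable_const _) (hS.integrable_exp _ hl),
    hφ.laplace _ _ (Real.toNNReal_pos.2 hr) hl, Real.coe_toNNReal _ hr.le]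
  simp

theorem IsSubordinator.integrable_tail (hS : IsSubordinator P S) (t r : ℝ) :
    Integrable (fun ω => {ω | t ≤ S r.toNNReal ω}.indicator (fun _ => (1 : ℝ)) ω) P :=
  (integrable_const _).indicator (hS.measurableSet_tail t r)

theorem tail_le_one (t r : ℝ) : tail P S t r ≤ 1 := measureReal_le_one

/-- Chebyshev bound for the upper tail in terms of the Laplace exponent. -/
theorem tail_mul_le (hS : IsSubordinator P S) (hφ : IsDriftlessLaplaceExponent P S φ)
    {t r θ : ℝ} (ht : 0 < t) (hr : 0 < r) (hθ : 0 < θ) :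
    tail P S t r * (1 - Real.exp (-θ)) ≤ 1 - Real.exp (-r * φ (θ / t)) := by
  rw [← hφ.integral_one_sub_exp hS hr (div_pos hθ ht), hS.tail_eq_integral, ← integral_mul_const]
  refine integral_mono_ae ((hS.integrable_tail t r).mul_const _)
    (hS.integrable_one_sub_exp _ (div_pos hθ ht)) ?_
  filter_upwards [hS.nonneg_ae r.toNNReal] with ω h
  by_cases hω : t ≤ S r.toNNReal ω
  · rw [indicator_of_mem (by exact hω), one_mul]
    have : θ ≤ θ / t * S r.toNNReal ω := by
      rw [div_mul_eq_mul_div, le_div_iff₀ ht]; gcongr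
    have := Real.exp_le_exp.2 (show -(θ / t) * S r.toNNReal ω ≤ -θ by linarith)
    linarith
  · rw [indicator_of_notMem (by exact hω), zero_mul]
    have : 0 ≤ θ / t * S r.toNNReal ω := by positivity
    have := Real.exp_le_one_iff.2 (show -(θ / t) * S r.toNNReal ω ≤ 0 by linarith)
    linarith

/-- Chernoff bound: on `S_r < t` the variable `exp (1 - S_r / t)` is at least `1`. -/
theorem one_sub_tail_le (hS : IsSubordinator P S) (hφ : IsDriftlessLaplaceExponent P S φ)
    {t r : ℝ} (ht : 0 < t) (hr : 0 < r) :
    1 - tail P S t r ≤ Real.exp (1 - r * φ t⁻¹) := by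
  have h1 := hφ.laplace _ _ (Real.toNNReal_pos.2 hr) (inv_pos.2 ht)
  rw [Real.coe_toNNReal _ hr.le] at h1
  have h2 : Real.exp (1 - r * φ t⁻¹) = ∫ ω, Real.exp 1 * Real.exp (-t⁻¹ * S r.toNNReal ω) ∂P := by
    rw [integral_const_mul, h1, ← Real.exp_add]; ring_nf
  have h3 : 1 - tail P S t r
      = ∫ ω, (1 - {ω | t ≤ S r.toNNReal ω}.indicator (fun _ => (1 : ℝ)) ω) ∂P := by
    rw [integral_sub (integrable_const _) (hS.integrable_tail t r), hS.tail_eq_integral]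
    simp
  rw [h2, h3]
  refine integral_mono ((integrable_const _).sub (hS.integrable_tail t r))
    ((hS.integrable_exp _ (inv_pos.2 ht)).const_mul _) fun ω => ?_
  by_cases hω : t ≤ S r.toNNReal ω
  · simp only [indicator_of_mem (show ω ∈ {ω | t ≤ S r.toNNReal ω} from hω)]
    rw [sub_self]; positivity
  · simp only [indicator_of_notMem (show ω ∉ {ω | t ≤ S r.toNNReal ω} from hω)]
    rw [← Real.exp_add, sub_zero, Real.one_le_exp_iff]
    have : t⁻¹ * S r.toNNReal ω ≤ t⁻¹ * t := by
      gcongr; exact (not_le.1 hω).le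
    rw [inv_mul_cancel₀ ht.ne'] at this
    linarith

/-- With `x = S_r / t`, the integrands are compared pointwise. For `x ≥ 1` the indicator alone
suffices. For `0 ≤ x ≤ 1`, `1 - e^{-εx} ≤ εx` and `x ≤ e (1 - e^{-x})`, so small values of `S_r`
contribute only a multiple of `ε`. -/
theorem one_sub_exp_le_tail_add (hS : IsSubordinator P S) (hφ : IsDriftlessLaplaceExponent P S φ)
    {t r ε : ℝ} (ht : 0 < t) (hr : 0 < r) (hε : 0 < ε) :
    1 - Real.exp (-r * φ (ε / t)) ≤
      tail P S t r + ε * Real.exp 1 * (1 - Real.exp (-r * φ t⁻¹)) := by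
  rw [← hφ.integral_one_sub_exp hS hr (div_pos hε ht),
    ← hφ.integral_one_sub_exp hS hr (inv_pos.2 ht), hS.tail_eq_integral, ← integral_const_mul,
    ← integral_add (hS.integrable_tail t r)
      ((hS.integrable_one_sub_exp r.toNNReal (inv_pos.2 ht)).const_mul _)]
  refine integral_mono_ae (hS.integrable_one_sub_exp _ (div_pos hε ht))
    ((hS.integrable_tail t r).add
      ((hS.integrable_one_sub_exp _ (inv_pos.2 ht)).const_mul _)) ?_
  filter_upwards [hS.nonneg_ae r.toNNReal] with ω h
  set s := S r.toNNReal ω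
  have hx : 0 ≤ t⁻¹ * s := by positivity
  have h0 : 0 ≤ 1 - Real.exp (-t⁻¹ * s) := by
    have := Real.exp_le_one_iff.2 (show -t⁻¹ * s ≤ 0 by linarith)
    linarith
  by_cases hω : t ≤ s
  · simp only [indicator_of_mem (show ω ∈ {ω | t ≤ S r.toNNReal ω} from hω)]
    have := Real.exp_pos (-(ε / t) * s)
    have : 0 ≤ ε * Real.exp 1 * (1 - Real.exp (-t⁻¹ * s)) := by positivity
    linarith
  · simp only [indicator_of_notMem (show ω ∉ {ω | t ≤ S r.toNNReal ω} from hω)]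
    have hx1 : t⁻¹ * s ≤ 1 := by
      have : t⁻¹ * s ≤ t⁻¹ * t := by
        gcongr; exact (not_le.1 hω).le
      rwa [inv_mul_cancel₀ ht.ne'] at this
    have e1 : -(ε / t) * s = -(ε * (t⁻¹ * s)) := by ring
    have e2 : -t⁻¹ * s = -(t⁻¹ * s) := by ring
    rw [e1, e2, zero_add]
    generalize t⁻¹ * s = x at *
    have h1 : 1 - Real.exp (-(ε * x)) ≤ ε * x := by
      linarith [Real.add_one_le_exp (-(ε * x))]
    have h2 : x ≤ Real.exp 1 * (1 - Real.exp (-x)) := by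
      have h3 : x * Real.exp (-x) ≤ 1 - Real.exp (-x) := by
        have h4 := mul_le_mul_of_nonneg_right (Real.add_one_le_exp x) (Real.exp_pos (-x)).le
        rw [← Real.exp_add, add_neg_cancel, Real.exp_zero] at h4
        linarith
      have h5 : 1 ≤ Real.exp 1 * Real.exp (-x) := by
        rw [← Real.exp_add, Real.one_le_exp_iff]; linarith
      nlinarith [Real.exp_pos 1]
    calc _ ≤ ε * x := h1
      _ ≤ ε * (Real.exp 1 * (1 - Real.exp (-x))) := by gcongr
      _ = _ := by ring

theorem WeakScaling.pos {Ψ : ℝ → ℝ} {a₁ a₂ : ℝ} (h : WeakScaling Ψ a₁ a₂) {r : ℝ} (hr : 0 < r) :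
    0 < Ψ r :=
  WeakScalingUniformly.pos h () r hr

theorem WeakScaling.mono {Ψ : ℝ → ℝ} {a₁ a₂ : ℝ} (h : WeakScaling Ψ a₁ a₂) {r R : ℝ} (hr : 0 < r)
    (hR : r ≤ R) : Ψ r ≤ Ψ R :=
  WeakScalingUniformly.mono h () hr (hr.trans_le hR) hR

theorem tail_le_mul (hS : IsSubordinator P S) (hφ : IsDriftlessLaplaceExponent P S φ)
    {t r : ℝ} (ht : 0 < t) (hr : 0 < r) :
    tail P S t r ≤ (1 - Real.exp (-1))⁻¹ * (r * φ t⁻¹) := by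
  have h := tail_mul_le hS hφ ht hr one_pos
  have h1 : 0 < 1 - Real.exp (-1) := by
    have : Real.exp (-1) < 1 := Real.exp_lt_one_iff.2 (by norm_num)
    linarith
  rw [inv_mul_eq_div, le_div_iff₀ h1]
  rw [one_div] at h
  linarith [Real.add_one_le_exp (-r * φ t⁻¹)]

/-- In `one_sub_exp_le_tail_add` the left side is at least of order `ε^β₂ r φ(1/t)` by scaling,
while the error is of order `ε r φ(1/t)`. Since `β₂ < 1`, a small `ε` lets the error be absorbed. -/
theorem exists_mul_le_tail (hS : IsSubordinator P S) (hφ : IsDriftlessLaplaceExponent P S φ)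
    (hφs : WeakScaling φ β₁ β₂) (hβ₂ : β₂ < 1) :
    ∃ c : ℝ, 0 < c ∧ ∀ t r : ℝ, 0 < t → 0 < r → r * φ t⁻¹ ≤ 1 → c * (r * φ t⁻¹) ≤ tail P S t r := by
  obtain ⟨c₁, c₂, hc₁, hc₂, hsc⟩ := hφs.scaling
  have e0 := Real.exp_pos 1
  have hb : 0 < 1 - β₂ := by linarith
  -- The choice `ε^(1 - β₂) = η` makes the error at most `ε^β₂ / (4 c₂)` times `r φ(1/t)`, half of
  -- the main term `ε^β₂ / (2 c₂)`.
  set η : ℝ := min 1 (4 * Real.exp 1 * c₂)⁻¹ with hη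
  have hη0 : 0 < η := by positivity
  set ε : ℝ := η ^ (1 - β₂)⁻¹ with hεdef
  have hε0 : 0 < ε := by positivity
  have hε1 : ε ≤ 1 := Real.rpow_le_one hη0.le (min_le_left _ _) (by positivity)
  have hεp : ε ^ (1 - β₂) = η := by
    rw [hεdef, ← Real.rpow_mul hη0.le, inv_mul_cancel₀ hb.ne', Real.rpow_one]
  have hεβ : ε = ε ^ β₂ * η := by
    rw [← hεp, ← Real.rpow_add hε0]; simp
  refine ⟨ε ^ β₂ / (4 * c₂), by positivity, fun t r ht hr h1 => ?_⟩
  have ht' : 0 < t⁻¹ := inv_pos.2 ht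
  have hεt : 0 < ε / t := by positivity
  have hle : ε / t ≤ t⁻¹ := by
    rw [div_eq_mul_inv]; exact mul_le_of_le_one_left ht'.le hε1
  have hA := one_sub_exp_le_tail_add hS hφ ht hr hε0
  have hp := hφs.pos hεt
  have hp' := hφs.pos ht'
  have hm := hφs.mono hεt hle
  have hlow : ε ^ β₂ / c₂ * φ t⁻¹ ≤ φ (ε / t) := by
    have h := (hsc () _ _ hεt hle).2
    rw [div_le_iff₀ hp] at h
    have e : t⁻¹ / (ε / t) = ε⁻¹ := by field_simp
    rw [e, Real.inv_rpow hε0.le] at h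
    have hpos : 0 < ε ^ β₂ := by positivity
    calc ε ^ β₂ / c₂ * φ t⁻¹ ≤ ε ^ β₂ / c₂ * (c₂ * (ε ^ β₂)⁻¹ * φ (ε / t)) := by gcongr
      _ = φ (ε / t) := by field_simp
  have hx1 : r * φ (ε / t) ≤ 1 := le_trans (by gcongr) h1
  have hx0 : 0 ≤ r * φ (ε / t) := by positivity
  have hB : r * φ (ε / t) / 2 ≤ 1 - Real.exp (-r * φ (ε / t)) := by
    rw [neg_mul]
    generalize r * φ (ε / t) = x at *
    have := Real.abs_exp_sub_one_sub_id_le (x := -x) (by rw [abs_neg, abs_of_nonneg hx0]; exact hx1)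
    have h3 := (abs_le.1 this).2
    have h4 : Real.exp (-x) * (x + 1) ≤ 1 := by
      have := mul_le_mul_of_nonneg_left (Real.add_one_le_exp x) (Real.exp_pos (-x)).le
      rwa [← Real.exp_add, neg_add_cancel, Real.exp_zero] at this
    nlinarith [Real.exp_pos (-x)]
  have hC : 1 - Real.exp (-r * φ t⁻¹) ≤ r * φ t⁻¹ := by
    linarith [Real.add_one_le_exp (-r * φ t⁻¹)]
  have hD : ε * Real.exp 1 ≤ ε ^ β₂ / (4 * c₂) := by
    calc ε * Real.exp 1 = ε ^ β₂ * η * Real.exp 1 := by rw [← hεβ]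
      _ ≤ ε ^ β₂ * (4 * Real.exp 1 * c₂)⁻¹ * Real.exp 1 := by
        gcongr; exact min_le_right _ _
      _ = _ := by field_simp
  have hE : ε * Real.exp 1 * (1 - Real.exp (-r * φ t⁻¹)) ≤ ε ^ β₂ / (4 * c₂) * (r * φ t⁻¹) := by
    calc _ ≤ ε * Real.exp 1 * (r * φ t⁻¹) := by gcongr
      _ ≤ _ := by gcongr
  have hF : ε ^ β₂ / c₂ * (r * φ t⁻¹) / 2 ≤ r * φ (ε / t) / 2 := by
    have := mul_le_mul_of_nonneg_left hlow hr.le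
    linarith
  have hG : ε ^ β₂ / c₂ * (r * φ t⁻¹) / 2 = 2 * (ε ^ β₂ / (4 * c₂) * (r * φ t⁻¹)) := by
    field_simp; norm_num
  linarith

/-- Use the Chebyshev bound at a large `θ`: as `φ` grows with exponent below `1`, `r φ(θ/t) ≤ θ/2`,
and the tail is at most `(1 - e^{-θ/2}) / (1 - e^{-θ}) = 1 / (1 + e^{-θ/2}) < 1`. The range up to
`2` allows an application at `2 * r`. -/
theorem exists_tail_le_one_sub (hS : IsSubordinator P S) (hφ : IsDriftlessLaplaceExponent P S φ)
    (hφs : WeakScaling φ β₁ β₂) (hβ₂ : β₂ < 1) :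
    ∃ δ : ℝ, 0 < δ ∧ ∀ t r : ℝ, 0 < t → 0 < r → r * φ t⁻¹ ≤ 2 → tail P S t r ≤ 1 - δ := by
  obtain ⟨c₁, c₂, hc₁, hc₂, hsc⟩ := hφs.scaling
  have hb : 0 < 1 - β₂ := by linarith
  -- Chosen so that `θ^(1 - β₂) = η ≥ 4 c₂`, that is `2 c₂ θ^β₂ ≤ θ / 2`.
  set η : ℝ := max 1 (4 * c₂) with hη
  have hη1 : 1 ≤ η := le_max_left _ _
  have hη0 : 0 < η := by positivity
  set θ : ℝ := η ^ (1 - β₂)⁻¹ with hθdef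
  have hθ0 : 0 < θ := by positivity
  have hθ1 : 1 ≤ θ := Real.one_le_rpow hη1 (by positivity)
  have hθp : θ ^ (1 - β₂) = η := by
    rw [hθdef, ← Real.rpow_mul hη0.le, inv_mul_cancel₀ hb.ne', Real.rpow_one]
  have hθβ : θ = θ ^ β₂ * η := by
    rw [← hθp, ← Real.rpow_add hθ0]; simp
  set e := Real.exp (-(θ / 2)) with he
  have he0 : 0 < e := Real.exp_pos _
  have he1 : e < 1 := Real.exp_lt_one_iff.2 (by linarith)
  have hee : Real.exp (-θ) = e * e := by rw [he, ← Real.exp_add]; ring_nf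
  refine ⟨e / (1 + e), by positivity, fun t r ht hr h1 => ?_⟩
  have ht' : 0 < t⁻¹ := inv_pos.2 ht
  have hA := tail_mul_le hS hφ ht hr hθ0
  have hp' := hφs.pos ht'
  have hle : t⁻¹ ≤ θ / t := by
    rw [div_eq_mul_inv]; exact le_mul_of_one_le_left ht'.le hθ1
  have hup : φ (θ / t) ≤ c₂ * θ ^ β₂ * φ t⁻¹ := by
    have h := (hsc () _ _ ht' hle).2
    rw [div_le_iff₀ hp'] at h
    have e : θ / t / t⁻¹ = θ := by field_simp
    rwa [e] at h
  have hup2 : r * φ (θ / t) ≤ θ / 2 := by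
    calc r * φ (θ / t) ≤ r * (c₂ * θ ^ β₂ * φ t⁻¹) := by gcongr
      _ = (r * φ t⁻¹) * (c₂ * θ ^ β₂) := by ring
      _ ≤ 2 * (c₂ * θ ^ β₂) := by gcongr
      _ = θ ^ β₂ * (4 * c₂) / 2 := by ring
      _ ≤ θ ^ β₂ * η / 2 := by gcongr; exact le_max_right _ _
      _ = θ / 2 := by rw [← hθβ]
  have hB : e ≤ Real.exp (-r * φ (θ / t)) := Real.exp_le_exp.2 (by linarith)
  rw [hee] at hA
  have hC : tail P S t r * (1 + e) * (1 - e) ≤ 1 * (1 - e) := by nlinarith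
  have hD := le_of_mul_le_mul_right hC (by linarith)
  rw [show 1 - e / (1 + e) = 1 / (1 + e) by field_simp; ring, le_div_iff₀ (by positivity)]
  exact hD

/-- Doubling-type increments of the tail are at least of linear size. -/
theorem exists_mul_le_tail_sub (hS : IsSubordinator P S) (hφ : IsDriftlessLaplaceExponent P S φ)
    (hφs : WeakScaling φ β₁ β₂) (hβ₂ : β₂ < 1) :
    ∃ L c : ℝ, 1 < L ∧ 0 < c ∧ ∀ t r : ℝ, 0 < t → 0 < r → r * φ t⁻¹ ≤ 1 →
      c * (r * φ t⁻¹) ≤ tail P S t (L * r) - tail P S t (2 * r) := by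
  obtain ⟨c, hc, hlow⟩ := exists_mul_le_tail hS hφ hφs hβ₂
  obtain ⟨δ, hδ, hup⟩ := exists_tail_le_one_sub hS hφ hφs hβ₂
  have h1e : 0 < 1 - Real.exp (-1) := by
    have : Real.exp (-1) < 1 := Real.exp_lt_one_iff.2 (by norm_num)
    linarith
  set C : ℝ := (1 - Real.exp (-1))⁻¹ with hC
  have hC0 : 0 < C := by positivity
  -- Large enough that the linear lower bound at `L₀ * r` beats the linear upper bound `2 C r
  -- φ(1/t)` at `2 * r`.
  set L₀ : ℝ := (2 * C + 1) / c + 1 with hL₀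
  have hL₀1 : 1 < L₀ := by rw [hL₀]; have : 0 < (2 * C + 1) / c := by positivity
                           linarith
  -- Makes the Chernoff error `exp (1 - K)` at most `δ / 2`.
  set K : ℝ := max 1 (1 - Real.log (δ / 2)) with hK
  have hK1 : 1 ≤ K := le_max_left _ _
  have hKe : Real.exp (1 - K) ≤ δ / 2 := by
    rw [← Real.le_log_iff_exp_le (by positivity)]
    linarith [le_max_right 1 (1 - Real.log (δ / 2))]
  refine ⟨L₀ * K, min 1 (δ / 2), by nlinarith, by positivity, fun t r ht hr h1 => ?_⟩
  have hp := hφs.pos (inv_pos.2 ht)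
  have hx0 : 0 < r * φ t⁻¹ := by positivity
  -- If `L₀ * r` is still in the linear regime, compare the two linear bounds. Otherwise `r φ(1/t)`
  -- is of order one: the tail at `L₀ * K * r` is at least `1 - δ/2`, while at `2 * r` it is at most
  -- `1 - δ`.
  by_cases hcase : L₀ * (r * φ t⁻¹) ≤ 1
  · have hm : tail P S t (L₀ * r) ≤ tail P S t (L₀ * K * r) := by
      apply hS.monotone_tail t
      gcongr
      exact le_mul_of_one_le_right (by linarith) hK1
    have h2 := hlow t (L₀ * r) ht (by positivity) (by linarith)
    have h3 := tail_le_mul hS hφ ht (show 0 < 2 * r by positivity)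
    have h4 : c * (L₀ * r * φ t⁻¹) = (2 * C + 1 + c) * (r * φ t⁻¹) := by
      rw [hL₀]; field_simp
    have h5 : min 1 (δ / 2) * (r * φ t⁻¹) ≤ 1 * (r * φ t⁻¹) := by
      gcongr; exact min_le_left _ _
    nlinarith
  · push Not at hcase
    have h2 := hup t (2 * r) ht (by positivity) (by linarith)
    have h3 := one_sub_tail_le hS hφ ht (show 0 < L₀ * K * r by positivity)
    have h4 : Real.exp (1 - L₀ * K * r * φ t⁻¹) ≤ Real.exp (1 - K) := by
      apply Real.exp_le_exp.2
      nlinarith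
    have h5 : min 1 (δ / 2) * (r * φ t⁻¹) ≤ δ / 2 * 1 := by
      gcongr; exact min_le_right _ _
    linarith

/-- The Lebesgue–Stieltjes measure of `r ↦ P(S_r ≥ t)` has at most linear mass near zero. -/
theorem stieltjes_tail_Ioc_le (hS : IsSubordinator P S) (hφ : IsDriftlessLaplaceExponent P S φ)
    {t r : ℝ} (ht : 0 < t) (hr : 0 < r) :
    (hS.monotone_tail t).stieltjesFunction.measure (Ioc 0 r) ≤
      ENNReal.ofReal (2 * (1 - Real.exp (-1))⁻¹ * (r * φ t⁻¹)) := by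
  rw [StieltjesFunction.measure_Ioc]
  apply ENNReal.ofReal_le_ofReal
  rw [Monotone.stieltjesFunction_eq, Monotone.stieltjesFunction_eq]
  have h1 := (hS.monotone_tail t).le_rightLim (le_refl (0 : ℝ))
  have h2 := (hS.monotone_tail t).rightLim_le (show r < 2 * r by linarith)
  have h3 := tail_le_mul hS hφ ht (show 0 < 2 * r by positivity)
  have h4 := tail_nonneg (P := P) (S := S) t 0
  linarith

theorem stieltjes_tail_Ioi_le (hS : IsSubordinator P S) (t : ℝ) :
    (hS.monotone_tail t).stieltjesFunction.measure (Ioi 0) ≤ 1 := by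
  have hmono : Monotone fun n : ℕ => Ioc (0 : ℝ) n := fun m n h =>
    Ioc_subset_Ioc_right (by exact_mod_cast h)
  have hU : Ioi (0 : ℝ) = ⋃ n : ℕ, Ioc (0 : ℝ) n := by
    ext x
    simp only [mem_Ioi, mem_iUnion, mem_Ioc]
    exact ⟨fun h => (exists_nat_ge x).imp fun n hn => ⟨h, hn⟩, fun ⟨n, h, _⟩ => h⟩
  rw [hU, hmono.measure_iUnion]
  refine iSup_le fun n => ?_
  rw [StieltjesFunction.measure_Ioc]
  refine ENNReal.ofReal_le_one.2 ?_
  rw [Monotone.stieltjesFunction_eq, Monotone.stieltjesFunction_eq]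
  have h1 := (hS.monotone_tail t).le_rightLim (le_refl (0 : ℝ))
  have h2 := (hS.monotone_tail t).rightLim_le (show (n : ℝ) < n + 1 by linarith)
  have h3 := tail_le_one (P := P) (S := S) t (n + 1)
  have h4 := tail_nonneg (P := P) (S := S) t 0
  linarith

/-- The mass of `(r, L r]` is a difference of right limits, and the right limit at `r` is bounded by
the tail at `2 * r`; this is why the increment in `exists_mul_le_tail_sub` starts at `2 * r`. -/
theorem exists_le_stieltjes_tail_Ioc (hS : IsSubordinator P S)
    (hφ : IsDriftlessLaplaceExponent P S φ) (hφs : WeakScaling φ β₁ β₂) (hβ₂ : β₂ < 1) :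
    ∃ L c : ℝ, 1 < L ∧ 0 < c ∧ ∀ t r : ℝ, 0 < t → 0 < r → r * φ t⁻¹ ≤ 1 →
      ENNReal.ofReal (c * (r * φ t⁻¹)) ≤
        (hS.monotone_tail t).stieltjesFunction.measure (Ioc r (L * r)) := by
  obtain ⟨L, c, hL, hc, h⟩ := exists_mul_le_tail_sub hS hφ hφs hβ₂
  refine ⟨L, c, hL, hc, fun t r ht hr h1 => ?_⟩
  rw [StieltjesFunction.measure_Ioc]
  apply ENNReal.ofReal_le_ofReal
  rw [Monotone.stieltjesFunction_eq, Monotone.stieltjesFunction_eq]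
  have h1' := (hS.monotone_tail t).le_rightLim (le_refl (L * r))
  have h2 := (hS.monotone_tail t).rightLim_le (show r < 2 * r by linarith)
  have h3 := h t r ht hr h1
  linarith

end Subordinator

/-! ### Weak scaling of generalized inverses and compositions. -/

section Scaling

variable {Φ : ℝ → ℝ} {α₁ α₂ : ℝ}

theorem WeakScaling.exists_le (h : WeakScaling Φ α₁ α₂) (s : ℝ) : ∃ r, 0 < r ∧ s ≤ Φ r := by
  obtain ⟨c₁, c₂, hc₁, hc₂, hsc⟩ := h.scaling
  have ha := h.pos_left
  have h1 := h.pos one_pos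
  set R : ℝ := max 1 ((|s| / (c₁ * Φ 1)) ^ α₁⁻¹) with hR
  have hR1 : 1 ≤ R := le_max_left _ _
  refine ⟨R, by linarith, (le_abs_self s).trans ?_⟩
  have h2 := (hsc () 1 R one_pos hR1).1
  rw [le_div_iff₀ h1, div_one] at h2
  refine le_trans ?_ h2
  have h3 : |s| / (c₁ * Φ 1) ≤ R ^ α₁ := by
    calc |s| / (c₁ * Φ 1) = ((|s| / (c₁ * Φ 1)) ^ α₁⁻¹) ^ α₁ := by
          rw [← Real.rpow_mul (by positivity), inv_mul_cancel₀ ha.ne', Real.rpow_one]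
      _ ≤ R ^ α₁ := by gcongr; exact le_max_right _ _
  rw [div_le_iff₀ (by positivity)] at h3
  linarith

theorem WeakScaling.exists_lt (h : WeakScaling Φ α₁ α₂) {s : ℝ} (hs : 0 < s) :
    ∃ r, 0 < r ∧ Φ r < s := by
  obtain ⟨c₁, c₂, hc₁, hc₂, hsc⟩ := h.scaling
  have ha := h.pos_left
  have h1 := h.pos one_pos
  set R : ℝ := min 1 ((c₁ * s / (2 * Φ 1)) ^ α₁⁻¹) with hR
  have hR0 : 0 < R := by positivity
  refine ⟨R, hR0, ?_⟩
  have h2 := (hsc () R 1 hR0 (min_le_left _ _)).1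
  rw [le_div_iff₀ (h.pos hR0), one_div, Real.inv_rpow hR0.le] at h2
  have hRp : 0 < R ^ α₁ := by positivity
  have h3 : R ^ α₁ ≤ c₁ * s / (2 * Φ 1) := by
    calc R ^ α₁ ≤ ((c₁ * s / (2 * Φ 1)) ^ α₁⁻¹) ^ α₁ := by gcongr; exact min_le_right _ _
      _ = _ := by rw [← Real.rpow_mul (by positivity), inv_mul_cancel₀ ha.ne', Real.rpow_one]
  rw [le_div_iff₀ (by positivity)] at h3
  have h4 : c₁ * Φ R ≤ Φ 1 * R ^ α₁ := by
    calc c₁ * Φ R = (c₁ * (R ^ α₁)⁻¹ * Φ R) * R ^ α₁ := by field_simp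
      _ ≤ _ := by gcongr
  have h5 : 0 < c₁ * s := by positivity
  refine lt_of_mul_lt_mul_left (a := c₁) ?_ hc₁.le
  linarith

theorem bddBelow_inv (s : ℝ) : BddBelow {r : ℝ | 0 ≤ r ∧ s ≤ Φ r} := ⟨0, fun _ h => h.1⟩

theorem WeakScaling.inv_set_nonempty (h : WeakScaling Φ α₁ α₂) (s : ℝ) :
    {r : ℝ | 0 ≤ r ∧ s ≤ Φ r}.Nonempty :=
  (h.exists_le s).imp fun _ hr => ⟨hr.1.le, hr.2⟩

theorem WeakScaling.inv_pos (h : WeakScaling Φ α₁ α₂) (h0 : Φ 0 = 0) {s : ℝ} (hs : 0 < s) :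
    0 < inv Φ s := by
  obtain ⟨r, hr, hrs⟩ := h.exists_lt hs
  refine hr.trans_le (le_csInf (h.inv_set_nonempty s) fun u hu => ?_)
  by_contra! hur
  rcases hu.1.eq_or_lt with h1 | h1
  · have := hu.2
    rw [← h1, h0] at this
    linarith
  · linarith [h.mono h1 hur.le, hu.2]

theorem WeakScaling.inv_mono (h : WeakScaling Φ α₁ α₂) : Monotone (inv Φ) := fun s _ hst =>
  csInf_le_csInf (bddBelow_inv s) (h.inv_set_nonempty _) fun _ hr => ⟨hr.1, hst.trans hr.2⟩

theorem inv_apply (hΦ : StrictMonoOn Φ (Ici 0)) {r : ℝ} (hr : 0 ≤ r) : inv Φ (Φ r) = r :=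
  le_antisymm (csInf_le (bddBelow_inv _) ⟨hr, le_rfl⟩)
    (le_csInf ⟨r, hr, le_rfl⟩ fun _ hu => (hΦ.le_iff_le hr hu.1).1 hu.2)

theorem le_inv_of_apply_le (h : WeakScaling Φ α₁ α₂) (hΦ : StrictMonoOn Φ (Ici 0)) {r s : ℝ}
    (hr : 0 ≤ r) (hs : Φ r ≤ s) : r ≤ inv Φ s := by
  rw [← inv_apply hΦ hr]; exact h.inv_mono hs

/-- `Φ ∘ Φ⁻¹` is comparable to the identity even where `Φ` jumps. -/
theorem WeakScaling.apply_inv (h : WeakScaling Φ α₁ α₂) (h0 : Φ 0 = 0) :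
    ∃ c C : ℝ, 0 < c ∧ 0 < C ∧ ∀ s, 0 < s → c * s ≤ Φ (inv Φ s) ∧ Φ (inv Φ s) ≤ C * s := by
  obtain ⟨c₁, c₂, hc₁, hc₂, hsc⟩ := h.scaling
  -- `Φ` is at least `s` somewhere below `2 * inv Φ s` and less than `s` at `inv Φ s / 2`; passing
  -- from these points to `inv Φ s` costs one doubling factor.
  have hK : 0 < c₂ * 2 ^ α₂ := by positivity
  refine ⟨(c₂ * 2 ^ α₂)⁻¹, c₂ * 2 ^ α₂, by positivity, hK, fun s hs => ?_⟩
  have hi := h.inv_pos h0 hs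
  constructor
  · obtain ⟨u, hu, hu2⟩ := exists_lt_of_csInf_lt (h.inv_set_nonempty s)
      (show sInf {r : ℝ | 0 ≤ r ∧ s ≤ Φ r} < 2 * inv Φ s by
        change inv Φ s < _; linarith)
    have hu0 : 0 < u := hi.trans_le (csInf_le (bddBelow_inv s) hu)
    have h1 := h.mono hu0 hu2.le
    have h2 := (hsc () (inv Φ s) (2 * inv Φ s) hi (by linarith)).2
    rw [div_le_iff₀ (h.pos hi), mul_div_cancel_right₀ _ hi.ne'] at h2
    rw [inv_mul_le_iff₀ hK]
    linarith [hu.2]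
  · have hh : 0 < inv Φ s / 2 := by positivity
    have h1 : Φ (inv Φ s / 2) < s := by
      by_contra! hcon
      have := csInf_le (bddBelow_inv s) (show inv Φ s / 2 ∈ {r : ℝ | 0 ≤ r ∧ s ≤ Φ r} from
        ⟨hh.le, hcon⟩)
      change inv Φ s ≤ _ at this
      linarith
    have h2 := (hsc () (inv Φ s / 2) (inv Φ s) hh (by linarith)).2
    rw [div_le_iff₀ (h.pos hh), div_div_cancel₀ hi.ne'] at h2
    exact h2.trans (by gcongr)

/-- Apply the scaling of `Φ` at the points `inv Φ r` and `inv Φ R`, replace `Φ ∘ Φ⁻¹` by the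
identity up to constants, and solve for the ratio of inverses; solving swaps and inverts the
exponents. -/
theorem WeakScaling.inv (h : WeakScaling Φ α₁ α₂) (h0 : Φ 0 = 0) :
    WeakScaling (inv Φ) α₂⁻¹ α₁⁻¹ := by
  have ha := h.pos_left
  have ha2 : 0 < α₂ := ha.trans_le h.left_le_right
  obtain ⟨c, C, hc, hC, hcC⟩ := h.apply_inv h0
  obtain ⟨c₁, c₂, hc₁, hc₂, hsc⟩ := h.scaling
  refine ⟨by positivity, inv_anti₀ ha h.left_le_right, fun _ r hr => h.inv_pos h0 hr,
    fun _ => h.inv_mono.monotoneOn _, (c / C / c₂) ^ α₂⁻¹, (C / c / c₁) ^ α₁⁻¹,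
    by positivity, by positivity, fun _ r R hr hrR => ?_⟩
  have hR : 0 < R := hr.trans_le hrR
  have hi := h.inv_pos h0 hr
  have hI := h.inv_pos h0 hR
  have hle := h.inv_mono hrR
  have hq : 0 < TimeFractional.inv Φ R / TimeFractional.inv Φ r := by positivity
  obtain ⟨h1, h2⟩ := hsc () _ _ hi hle
  obtain ⟨h3, h4⟩ := hcC r hr
  obtain ⟨h5, h6⟩ := hcC R hR
  have hp := h.pos hi
  have hP := h.pos hI
  have hup : Φ (TimeFractional.inv Φ R) / Φ (TimeFractional.inv Φ r) ≤ C / c * (R / r) := by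
    calc _ ≤ (C * R) / (c * r) := by gcongr
      _ = _ := by field_simp
  have hlo : c / C * (R / r) ≤ Φ (TimeFractional.inv Φ R) / Φ (TimeFractional.inv Φ r) := by
    calc _ = (c * R) / (C * r) := by field_simp
      _ ≤ _ := by gcongr
  constructor
  · rw [← Real.mul_rpow (by positivity) (by positivity),
      Real.rpow_inv_le_iff_of_pos (by positivity) hq.le ha2, div_mul_eq_mul_div, div_le_iff₀ hc₂]
    linarith
  · rw [← Real.mul_rpow (by positivity) (by positivity),
      Real.le_rpow_inv_iff_of_pos hq.le (by positivity) ha, div_mul_eq_mul_div, le_div_iff₀ hc₁]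
    linarith

/-- Applied to the volume and `inv Φ`, this gives `V(x, Φ⁻¹(r))` the exponents `d₁/α₂` and `d₂/α₁`,
whose position relative to `1` separates the three cases. -/
theorem WeakScalingUniformly.comp {Λ : Type*} {V : Λ → ℝ → ℝ} {d₁ d₂ : ℝ}
    (hV : WeakScalingUniformly V d₁ d₂) (h : WeakScaling Φ α₁ α₂) :
    WeakScalingUniformly (fun x r => V x (Φ r)) (α₁ * d₁) (α₂ * d₂) := by
  have ha := h.pos_left
  have hd := hV.pos_left
  have ha2 : 0 < α₂ := ha.trans_le h.left_le_right
  have hd2 : 0 < d₂ := hd.trans_le hV.left_le_right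
  obtain ⟨c₁, c₂, hc₁, hc₂, hsc⟩ := h.scaling
  obtain ⟨b₁, b₂, hb₁, hb₂, hbc⟩ := hV.scaling
  refine ⟨by positivity, mul_le_mul h.left_le_right hV.left_le_right hd.le ha2.le,
    fun x r hr => hV.pos _ _ (h.pos hr),
    fun x r hr R hR hrR => hV.mono x (h.pos hr) (h.pos hR) (h.mono hr hrR),
    b₁ * c₁ ^ d₁, b₂ * c₂ ^ d₂, by positivity, by positivity, fun x r R hr hrR => ?_⟩
  have hR : 0 < R := hr.trans_le hrR
  obtain ⟨h1, h2⟩ := hsc () r R hr hrR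
  obtain ⟨h3, h4⟩ := hbc x _ _ (h.pos hr) (h.mono hr hrR)
  have hp := h.pos hr
  have hP := h.pos hR
  constructor
  · refine le_trans ?_ h3
    rw [mul_assoc, Real.rpow_mul (by positivity), ← Real.mul_rpow (by positivity) (by positivity)]
    gcongr
  · refine h4.trans ?_
    rw [mul_assoc, Real.rpow_mul (by positivity), ← Real.mul_rpow (by positivity) (by positivity)]
    gcongr

end Scaling

/-! ### Reduction of the jump and diffusion estimates to common kernel bounds. -/

section Kernel

variable {Φ : ℝ → ℝ} {α₁ α₂ : ℝ}

/-- If `m ≥ 1`, scaling gives `m^α₁ Φ(r/m) ≲ Φ(r) ≤ t`, while `Φ(r/m) ≳ t/m`; so `m^(α₁ - 1)` is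
bounded. Hence the exponential in the diffusion estimate is harmless near the diagonal. -/
theorem IsStepFunction.exists_le_of_apply_le {m : ℝ → ℝ → ℝ} (hm : IsStepFunction Φ m)
    (h : WeakScaling Φ α₁ α₂) (hα : 1 < α₁) :
    ∃ A : ℝ, ∀ t r : ℝ, 0 < t → 0 < r → Φ r ≤ t → m t r ≤ A := by
  obtain ⟨c₁, c₂, hc₁, hc₂, hsc⟩ := h.scaling
  obtain ⟨b₁, b₂, hb₁, hb₂, hbc⟩ := hm.scale
  refine ⟨max 1 ((b₂ / c₁) ^ (α₁ - 1)⁻¹), fun t r ht hr hrt => ?_⟩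
  have hp := hm.pos t r ht hr
  rcases le_total (m t r) 1 with h1 | h1
  · exact h1.trans (le_max_left _ _)
  refine le_trans ?_ (le_max_right _ _)
  rw [Real.le_rpow_inv_iff_of_pos hp.le (by positivity) (by linarith)]
  have h2 := (hbc t r ht hr).2
  have h3 := (hsc () (r / m t r) r (by positivity) (div_le_self hr.le h1)).1
  rw [div_div_cancel₀ hr.ne', le_div_iff₀ (h.pos (by positivity))] at h3
  have e : m t r ^ α₁ = m t r ^ (α₁ - 1) * m t r := by
    rw [← Real.rpow_add_one hp.ne', sub_add_cancel]
  rw [e] at h3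
  rw [le_div_iff₀ hc₁]
  have h4 : 0 < m t r ^ (α₁ - 1) := by positivity
  refine le_of_mul_le_mul_right (a := t) ?_ ht
  calc m t r ^ (α₁ - 1) * c₁ * t = c₁ * (m t r ^ (α₁ - 1) * m t r) * (t / m t r) := by field_simp
    _ ≤ c₁ * (m t r ^ (α₁ - 1) * m t r) * (b₂ * Φ (r / m t r)) := by gcongr
    _ = b₂ * (c₁ * (m t r ^ (α₁ - 1) * m t r) * Φ (r / m t r)) := by ring
    _ ≤ b₂ * Φ r := by gcongr
    _ ≤ b₂ * t := by gcongr

/-- Put `s = Φ⁻¹(t)` and `z = r/s ≥ 1`. If `m ≤ z`, scaling between `s` and `r/m` gives `t (z/m)^α₁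
≲ Φ(r/m) ≲ t/m`, so `(z/m)^(α₁ - 1) z` is bounded, and so is `z/m`. The diffusion kernel thus decays
at least exponentially in `z`. -/
theorem IsStepFunction.exists_mul_le {m : ℝ → ℝ → ℝ} (hm : IsStepFunction Φ m)
    (h : WeakScaling Φ α₁ α₂) (h0 : Φ 0 = 0) (hα : 1 < α₁) :
    ∃ κ : ℝ, 0 < κ ∧ ∀ t r : ℝ, 0 < t → inv Φ t ≤ r → κ * (r / inv Φ t) ≤ m t r := by
  obtain ⟨c₁, c₂, hc₁, hc₂, hsc⟩ := h.scaling
  obtain ⟨b₁, b₂, hb₁, hb₂, hbc⟩ := hm.scale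
  obtain ⟨e₁, e₂, he₁, he₂, hei⟩ := h.apply_inv h0
  set A : ℝ := (b₁ * c₁ * e₁)⁻¹ with hA
  have hA0 : 0 < A := by positivity
  set D : ℝ := max 1 (A ^ (α₁ - 1)⁻¹) with hD
  have hD1 : 1 ≤ D := le_max_left _ _
  have hD0 : 0 < D := by linarith
  refine ⟨D⁻¹, by positivity, fun t r ht htr => ?_⟩
  have hs := h.inv_pos h0 ht
  have hr : 0 < r := hs.trans_le htr
  have hp := hm.pos t r ht hr
  set s := TimeFractional.inv Φ t with hsdef
  have hz : 1 ≤ r / s := (one_le_div hs).2 htr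
  rw [inv_mul_le_iff₀ hD0, ← div_le_iff₀ hp]
  rcases le_total (r / s) (m t r) with h1 | h1
  · exact ((div_le_one hp).2 h1).trans hD1
  refine le_trans ?_ (le_max_right _ _)
  have hzm : 0 < r / s / m t r := by positivity
  rw [Real.le_rpow_inv_iff_of_pos hzm.le hA0.le (by linarith)]
  have hsm : s ≤ r / m t r := by
    rw [le_div_iff₀ hp]; rw [le_div_iff₀ hs] at h1; linarith
  have h2 := (hbc t r ht hr).1
  have h3 := (hsc () s (r / m t r) hs hsm).1
  rw [le_div_iff₀ (h.pos hs), show r / m t r / s = r / s / m t r by ring] at h3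
  have e : (r / s / m t r) ^ α₁ = (r / s / m t r) ^ (α₁ - 1) * (r / s / m t r) := by
    rw [← Real.rpow_add_one hzm.ne', sub_add_cancel]
  rw [e] at h3
  have h4 := (hei t ht).1
  set y := (r / s / m t r) ^ (α₁ - 1) with hy
  have hy0 : 0 < y := by positivity
  have h5 : b₁ * (c₁ * (y * (r / s / m t r)) * (e₁ * t)) ≤ t / m t r := by
    refine le_trans ?_ h2
    gcongr
    refine le_trans ?_ h3
    gcongr
  have h6 : y * (r / s) ≤ A := by
    rw [hA, ← one_div, le_div_iff₀ (by positivity)]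
    refine le_of_mul_le_mul_right (a := t / m t r) ?_ (by positivity)
    refine le_trans (le_of_eq ?_) (h5.trans (one_mul _).ge)
    ring
  exact (le_mul_of_one_le_right hy0.le hz).trans h6

theorem exists_rpow_mul_exp_neg_le (d : ℝ) {a : ℝ} (ha : 0 < a) :
    ∃ K : ℝ, 0 < K ∧ ∀ z : ℝ, 1 ≤ z → z ^ d * Real.exp (-(a * z)) ≤ K := by
  set n := ⌈d⌉₊
  refine ⟨n.factorial / a ^ n, by positivity, fun z hz => ?_⟩
  have hz0 : 0 < z := by linarith
  have h1 : z ^ d ≤ z ^ n := by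
    rw [← Real.rpow_natCast]
    exact Real.rpow_le_rpow_of_exponent_le hz (Nat.le_ceil d)
  have h2 := Real.pow_div_factorial_le_exp (a * z) (by positivity) n
  rw [div_le_iff₀ (by positivity), mul_pow] at h2
  rw [Real.exp_neg, ← div_eq_mul_inv, div_le_div_iff₀ (Real.exp_pos _) (by positivity)]
  calc z ^ d * a ^ n ≤ z ^ n * a ^ n := by gcongr
    _ ≤ _ := by linarith

variable {M : Type*} [MetricSpace M] [MeasurableSpace M] {μ : Measure M} {d₁ d₂ : ℝ}
  {q : ℝ → M → M → ℝ}

/-- The consequences of the two heat kernel conditions on which the estimates of the fundamental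
solution rest: on- and near-diagonal two-sided bounds, and boundedness by `1 / V(x, d(x, y))` for
small times. -/
structure KernelBounds (μ : Measure M) (Φ : ℝ → ℝ) (q : ℝ → M → M → ℝ) (c C : ℝ) : Prop where
  upper : ∀ r x y, 0 < r → q r x y ≤ C / vol μ x (inv Φ r)
  upper_off_diag : ∀ r x y, 0 < r → x ≠ y → r ≤ Φ (dist x y) → q r x y ≤ C / vol μ x (dist x y)
  lower : ∀ r x y, 0 < r → Φ (dist x y) ≤ r → c / vol μ x (inv Φ r) ≤ q r x y

/-- For `r ≤ Φ(d)` the factor `r / Φ(d)` in the jump term is at most `1`. For `Φ(d) ≤ r` one has `d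
≤ Φ⁻¹(r)`, so the jump term dominates the on-diagonal term. -/
theorem JumpEstimate.exists_kernelBounds (hq : JumpEstimate μ Φ q)
    (hV : WeakScalingUniformly (vol μ) d₁ d₂) (h : WeakScaling Φ α₁ α₂)
    (hΦ : StrictMonoOn Φ (Ici 0)) :
    ∃ c C : ℝ, 0 < c ∧ 0 < C ∧ KernelBounds μ Φ q c C := by
  obtain ⟨c, C, hc, hC, hq⟩ := hq
  refine ⟨c, C, hc, hC, fun r x y hr => ?_, fun r x y hr hxy hr' => ?_, fun r x y hr hr' => ?_⟩
  · refine (hq r x y hr).2.trans ?_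
    rw [← mul_one_div C]
    gcongr
    unfold jumpProfile
    split_ifs
    exacts [le_rfl, min_le_left _ _]
  · have hd : 0 < dist x y := dist_pos.2 hxy
    have hv := hV.pos x _ hd
    refine (hq r x y hr).2.trans ?_
    rw [← mul_one_div C]
    gcongr
    unfold jumpProfile
    rw [if_neg hd.ne']
    refine (min_le_right _ _).trans ?_
    rw [div_le_div_iff₀ (mul_pos hv (h.pos hd)) hv]
    nlinarith
  · refine le_trans ?_ (hq r x y hr).1
    rw [← mul_one_div c]
    gcongr
    unfold jumpProfile
    split_ifs with hd
    · exact le_rfl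
    · have hd : 0 < dist x y := lt_of_le_of_ne dist_nonneg (Ne.symm hd)
      have hv := hV.pos x _ hd
      have hi := le_inv_of_apply_le h hΦ hd.le hr'
      have hvi := hV.mono x hd (hd.trans_le hi) hi
      refine le_min le_rfl ?_
      rw [div_le_div_iff₀ (hV.pos x _ (hd.trans_le hi)) (mul_pos hv (h.pos hd)), one_mul]
      calc _ ≤ vol μ x (dist x y) * r := by gcongr
        _ = r * vol μ x (dist x y) := mul_comm _ _
        _ ≤ _ := by gcongr

/-- Off the diagonal, replacing `V(x, Φ⁻¹(r))` by `V(x, d)` costs a factor `z^d₂` with `z = d /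
Φ⁻¹(r)`, which the exponential decay in `z` absorbs. -/
theorem DiffusionEstimate.exists_kernelBounds (hq : DiffusionEstimate μ Φ q)
    (hV : WeakScalingUniformly (vol μ) d₁ d₂) (h : WeakScaling Φ α₁ α₂)
    (hΦ : StrictMonoOn Φ (Ici 0)) (h0 : Φ 0 = 0) (hα : 1 < α₁) :
    ∃ c C : ℝ, 0 < c ∧ 0 < C ∧ KernelBounds μ Φ q c C := by
  obtain ⟨m, hm, c₁, c₂, c₃, c₄, hc₁, hc₂, hc₃, hc₄, hq⟩ := hq
  obtain ⟨A, hA⟩ := hm.exists_le_of_apply_le h hα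
  obtain ⟨κ, hκ, hκm⟩ := hm.exists_mul_le h h0 hα
  obtain ⟨K, hK, hKz⟩ := exists_rpow_mul_exp_neg_le d₂ (mul_pos hc₄ hκ)
  obtain ⟨b₁, b₂, hb₁, hb₂, hb⟩ := hV.scaling
  -- The maximum with `0` covers `x = y`, where `m` vanishes and `A` gives no information.
  refine ⟨c₁ * Real.exp (-c₂ * max A 0), max c₃ (c₃ * b₂ * K), by positivity, by positivity,
    fun r x y hr => ?_, fun r x y hr hxy hr' => ?_, fun r x y hr hr' => ?_⟩
  · have hv := hV.pos x _ (h.inv_pos h0 hr)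
    have hm0 : 0 ≤ m r (dist x y) := by
      rcases dist_nonneg (x := x) (y := y) |>.eq_or_lt with hd | hd
      · rw [← hd, hm.zero r hr]
      · exact (hm.pos _ _ hr hd).le
    have h1 : Real.exp (-c₄ * m r (dist x y)) ≤ 1 := Real.exp_le_one_iff.2 (by nlinarith)
    calc q r x y ≤ _ := (hq r x y hr).2
      _ ≤ c₃ / vol μ x (inv Φ r) := mul_le_of_le_one_right (by positivity) h1
      _ ≤ _ := by gcongr; exact le_max_left _ _
  · have hd : 0 < dist x y := dist_pos.2 hxy
    have hs := h.inv_pos h0 hr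
    have hle : inv Φ r ≤ dist x y := by
      rw [← inv_apply hΦ hd.le]; exact h.inv_mono hr'
    have hv := hV.pos x _ hs
    have hvd := hV.pos x _ hd
    have h1 := (hb x _ _ hs hle).2
    have h2 := hκm r _ hr hle
    have hz : 1 ≤ dist x y / inv Φ r := (one_le_div hs).2 hle
    have h3 := hKz _ hz
    set z := dist x y / inv Φ r
    rw [div_le_iff₀ hv] at h1
    have h4 : Real.exp (-c₄ * m r (dist x y)) ≤ Real.exp (-(c₄ * κ * z)) :=
      Real.exp_le_exp.2 (by nlinarith)
    calc q r x y ≤ _ := (hq r x y hr).2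
      _ ≤ c₃ / vol μ x (inv Φ r) * Real.exp (-(c₄ * κ * z)) := by gcongr
      _ = c₃ * vol μ x (dist x y) / vol μ x (inv Φ r) * Real.exp (-(c₄ * κ * z))
          / vol μ x (dist x y) := by field_simp
      _ ≤ c₃ * (b₂ * z ^ d₂ * vol μ x (inv Φ r)) / vol μ x (inv Φ r) * Real.exp (-(c₄ * κ * z))
          / vol μ x (dist x y) := by gcongr
      _ = c₃ * b₂ * (z ^ d₂ * Real.exp (-(c₄ * κ * z))) / vol μ x (dist x y) := by field_simp
      _ ≤ c₃ * b₂ * K / vol μ x (dist x y) := by gcongr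
      _ ≤ _ := by gcongr; exact le_max_right _ _
  · have hv := hV.pos x _ (h.inv_pos h0 hr)
    refine le_trans ?_ (hq r x y hr).1
    rw [mul_div_right_comm]
    refine mul_le_mul_of_nonneg_left (Real.exp_le_exp.2 ?_) (by positivity)
    rw [neg_mul, neg_mul, neg_le_neg_iff]
    gcongr
    rcases dist_nonneg (x := x) (y := y) |>.eq_or_lt with hd | hd
    · rw [← hd, hm.zero r hr]; exact le_max_right _ _
    · exact (hA _ _ hr hd hr').trans (le_max_left _ _)

end Kernel

/-! ### Integration of a kernel of size `1 / W` over geometric scales. -/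

section Integrals

variable {ν : Measure ℝ}

theorem setLIntegral_le_ofReal_mul {s : Set ℝ} {f : ℝ → ℝ} {A B : ℝ} (hs : MeasurableSet s)
    (hA : 0 ≤ A) (hf : ∀ r ∈ s, f r ≤ A) (hν : ν s ≤ ENNReal.ofReal B) :
    ∫⁻ r in s, ENNReal.ofReal (f r) ∂ν ≤ ENNReal.ofReal (A * B) := by
  calc _ ≤ ∫⁻ _ in s, ENNReal.ofReal A ∂ν :=
        setLIntegral_mono' hs fun r hr => ENNReal.ofReal_le_ofReal (hf r hr)
    _ = ENNReal.ofReal A * ν s := setLIntegral_const _ _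
    _ ≤ ENNReal.ofReal A * ENNReal.ofReal B := by gcongr
    _ = _ := (ENNReal.ofReal_mul hA).symm

theorem ofReal_mul_le_setLIntegral {s : Set ℝ} {f : ℝ → ℝ} {A B : ℝ} (hs : MeasurableSet s)
    (hA : 0 ≤ A) (hf : ∀ r ∈ s, A ≤ f r) (hν : ENNReal.ofReal B ≤ ν s) :
    ENNReal.ofReal (A * B) ≤ ∫⁻ r in s, ENNReal.ofReal (f r) ∂ν := by
  calc _ = ENNReal.ofReal A * ENNReal.ofReal B := ENNReal.ofReal_mul hA
    _ ≤ ENNReal.ofReal A * ν s := by gcongr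
    _ = ∫⁻ _ in s, ENNReal.ofReal A ∂ν := (setLIntegral_const _ _).symm
    _ ≤ _ := setLIntegral_mono' hs fun r hr => ENNReal.ofReal_le_ofReal (hf r hr)

theorem setLIntegral_iUnion_le_of_geometric {s : ℕ → Set ℝ} {f : ℝ → ℝ≥0∞} {A y : ℝ}
    (hA : 0 ≤ A) (hy : 0 ≤ y) (hy1 : y < 1)
    (h : ∀ k, ∫⁻ r in s k, f r ∂ν ≤ ENNReal.ofReal (A * y ^ k)) :
    ∫⁻ r in ⋃ k, s k, f r ∂ν ≤ ENNReal.ofReal (A * (1 - y)⁻¹) := by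
  calc _ ≤ ∑' k, ∫⁻ r in s k, f r ∂ν := lintegral_iUnion_le _ _
    _ ≤ ∑' k, ENNReal.ofReal (A * y ^ k) := ENNReal.tsum_le_tsum h
    _ = ENNReal.ofReal (∑' k, A * y ^ k) :=
        (ENNReal.ofReal_tsum_of_nonneg (fun k => by positivity)
          ((summable_geometric_of_lt_one hy hy1).mul_left A)).symm
    _ = _ := by rw [tsum_mul_left, tsum_geometric_of_lt_one hy hy1]

theorem lintegral_biUnion_finset_le {ι : Type*} (I : Finset ι) (s : ι → Set ℝ) (f : ℝ → ℝ≥0∞) :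
    ∫⁻ r in ⋃ i ∈ I, s i, f r ∂ν ≤ ∑ i ∈ I, ∫⁻ r in s i, f r ∂ν := by
  classical
  induction I using Finset.induction_on with
  | empty => simp
  | insert i I hi ih =>
    rw [Finset.set_biUnion_insert, Finset.sum_insert hi]
    exact (lintegral_union_le _ _ _).trans (by gcongr)

variable {W q : ℝ → ℝ} {u a B C K γ : ℝ}

theorem setLIntegral_Icc_le (hW : ∀ r, 0 < r → 0 < W r) (hmono : MonotoneOn W (Ioi 0))
    (hK : 0 ≤ K) (hq : ∀ r, 0 < r → q r ≤ K / W r)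
    (hν : ∀ r, 0 < r → ν (Ioc 0 r) ≤ ENNReal.ofReal (C * (r * u))) {r : ℝ} (hr : 0 < r) :
    ∫⁻ s in Icc r (2 * r), ENNReal.ofReal (q s) ∂ν ≤
      ENNReal.ofReal (K / W r * (C * (2 * r * u))) := by
  have hWr := hW r hr
  refine setLIntegral_le_ofReal_mul measurableSet_Icc (by positivity) (fun s hs => ?_)
    ((measure_mono (Icc_subset_Ioc hr le_rfl)).trans (hν _ (by positivity)))
  have hs0 : 0 < s := hr.trans_le hs.1
  have := hmono hr hs0 hs.1
  exact (hq s hs0).trans (by gcongr)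

theorem setLIntegral_Ioi_le (hu : 0 < u) (hW : ∀ r, 0 < r → 0 < W r)
    (hmono : MonotoneOn W (Ioi 0)) (hK : 0 ≤ K) (hq : ∀ r, 0 < r → q r ≤ K / W r)
    (hν : ν (Ioi 0) ≤ 1) :
    ∫⁻ s in Ioi (1 / u), ENNReal.ofReal (q s) ∂ν ≤ ENNReal.ofReal (K / W (1 / u)) := by
  have hT : 0 < 1 / u := by positivity
  have hWT := hW _ hT
  have := setLIntegral_le_ofReal_mul (ν := ν) (s := Ioi (1 / u)) (f := q) (A := K / W (1 / u))
    (B := 1) measurableSet_Ioi (by positivity) (fun s hs => ?_)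
    ((measure_mono (Ioi_subset_Ioi hT.le)).trans (by simpa using hν))
  · rwa [mul_one] at this
  · have hs0 : 0 < s := hT.trans hs
    have := hmono hT hs0 (le_of_lt hs)
    exact (hq s hs0).trans (by gcongr)

theorem setLIntegral_Ioc_zero_le {D : ℝ} (hD : 0 ≤ D) (ha : 0 < a)
    (hq : ∀ r, 0 < r → r ≤ a → q r ≤ D)
    (hν : ∀ r, 0 < r → ν (Ioc 0 r) ≤ ENNReal.ofReal (C * (r * u))) :
    ∫⁻ s in Ioc 0 a, ENNReal.ofReal (q s) ∂ν ≤ ENNReal.ofReal (D * (C * (a * u))) :=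
  setLIntegral_le_ofReal_mul measurableSet_Ioc hD (fun s hs => hq s hs.1 hs.2) (hν a ha)

/-- Upper bound when `W` grows slower than linearly: the main contribution is at the scale
`1 / u`. -/
theorem lintegral_le_of_sublinear (hu : 0 < u) (hC : 0 ≤ C) (hB : 0 ≤ B) (hγ : γ < 1)
    (hW : ∀ r, 0 < r → 0 < W r) (hmono : MonotoneOn W (Ioi 0))
    (hup : ∀ r R, 0 < r → r ≤ R → W R ≤ B * (R / r) ^ γ * W r)
    (hK : 0 ≤ K) (hq : ∀ r, 0 < r → q r ≤ K / W r)
    (hν : ∀ r, 0 < r → ν (Ioc 0 r) ≤ ENNReal.ofReal (C * (r * u))) (hν1 : ν (Ioi 0) ≤ 1) :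
    ∫⁻ s in Ioi 0, ENNReal.ofReal (q s) ∂ν ≤
      ENNReal.ofReal ((2 * K * B * C * (1 - (1 / 2 : ℝ) ^ (1 - γ))⁻¹ + K) / W (1 / u)) := by
  have hT : 0 < 1 / u := by positivity
  have hWT := hW _ hT
  set T := 1 / u with hTdef
  have hTu : T * u = 1 := by rw [hTdef]; field_simp
  -- Ratio of the block bounds as the scale is halved: the mass bound gains `1/2`, and `1 / W` loses
  -- at most `2^γ` up to a constant.
  set y : ℝ := (1 / 2 : ℝ) ^ (1 - γ) with hy
  have hy0 : 0 < y := by positivity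
  have hy1 : y < 1 := Real.rpow_lt_one (by norm_num) (by norm_num) (by linarith)
  have hsub : Ioi (0 : ℝ) ⊆
      (⋃ k : ℕ, Icc ((1 / 2) ^ (k + 1) * T) (2 * ((1 / 2) ^ (k + 1) * T))) ∪ Ioi T := by
    intro s hs
    rcases lt_or_ge T s with h | h
    · exact Or.inr h
    · left
      obtain ⟨k, hk1, hk2⟩ := exists_nat_pow_near_of_lt_one (x := s / T) (y := (1 / 2 : ℝ))
        (div_pos hs hT) ((div_le_one hT).2 h) (by norm_num) (by norm_num)
      rw [lt_div_iff₀ hT] at hk1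
      rw [div_le_iff₀ hT] at hk2
      refine mem_iUnion.2 ⟨k, hk1.le, hk2.trans (le_of_eq ?_)⟩
      ring
  have hblock : ∀ k : ℕ,
      ∫⁻ s in Icc ((1 / 2) ^ (k + 1) * T) (2 * ((1 / 2) ^ (k + 1) * T)), ENNReal.ofReal (q s) ∂ν
        ≤ ENNReal.ofReal (2 * K * B * C / W T * y ^ k) := by
    intro k
    set p : ℝ := (1 / 2) ^ (k + 1) with hp
    have hp0 : 0 < p := by positivity
    have hp1 : p ≤ 1 := pow_le_one₀ (by norm_num) (by norm_num)
    have hr : 0 < p * T := by positivity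
    have hWr := hW _ hr
    refine (setLIntegral_Icc_le hW hmono hK hq hν hr).trans (ENNReal.ofReal_le_ofReal ?_)
    have h1 := hup (p * T) T hr (mul_le_of_le_one_left hT.le hp1)
    have e1 : T / (p * T) = p⁻¹ := by field_simp
    rw [e1, Real.inv_rpow hp0.le, ← Real.rpow_neg hp0.le] at h1
    have h2 : K / W (p * T) ≤ K * (B * p ^ (-γ)) / W T := by
      rw [div_le_div_iff₀ hWr hWT]
      calc K * W T ≤ K * (B * p ^ (-γ) * W (p * T)) := by gcongr
        _ = _ := by ring
    have h3 : p ^ (-γ) * p = y ^ (k + 1) := by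
      rw [← Real.rpow_add_one hp0.ne', hp, hy, ← Real.rpow_natCast, ← Real.rpow_natCast,
        ← Real.rpow_mul (by norm_num), ← Real.rpow_mul (by norm_num)]
      ring_nf
    calc K / W (p * T) * (C * (2 * (p * T) * u))
        ≤ K * (B * p ^ (-γ)) / W T * (C * (2 * (p * T) * u)) := by gcongr
      _ = 2 * K * B * C / W T * (p ^ (-γ) * p) * (T * u) := by ring
      _ = 2 * K * B * C / W T * y ^ (k + 1) := by rw [hTu, h3, mul_one]
      _ ≤ 2 * K * B * C / W T * y ^ k := by
        gcongr ?_ * ?_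
        exact pow_le_pow_of_le_one hy0.le hy1.le (Nat.le_succ k)
  have h1y : 0 < 1 - y := by linarith
  calc _ ≤ _ := lintegral_mono_set hsub
    _ ≤ _ := lintegral_union_le _ _ _
    _ ≤ ENNReal.ofReal (2 * K * B * C / W T * (1 - y)⁻¹) + ENNReal.ofReal (K / W T) :=
        add_le_add (setLIntegral_iUnion_le_of_geometric (by positivity) hy0.le hy1 hblock)
          (setLIntegral_Ioi_le hu hW hmono hK hq hν1)
    _ = _ := by
        rw [← ENNReal.ofReal_add (by positivity) (by positivity)]
        congr 1
        ring

theorem Ioi_subset_iUnion_Icc_two_pow (ha : 0 < a) :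
    Ioi a ⊆ ⋃ k : ℕ, Icc (2 ^ k * a) (2 * (2 ^ k * a)) := by
  intro s hs
  obtain ⟨k, hk1, hk2⟩ := exists_nat_pow_near (x := s / a) (y := (2 : ℝ))
    ((one_le_div ha).2 (le_of_lt hs)) (by norm_num)
  rw [le_div_iff₀ ha] at hk1
  rw [div_lt_iff₀ ha] at hk2
  refine mem_iUnion.2 ⟨k, hk1, hk2.le.trans (le_of_eq ?_)⟩
  ring

/-- Upper bound when `W` grows faster than linearly: the main contribution is at the scale `a`
below which the kernel is bounded. -/
theorem lintegral_le_of_superlinear (hu : 0 < u) (ha : 0 < a) (hC : 0 ≤ C) (hB : 0 < B)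
    (hγ : 1 < γ) (hW : ∀ r, 0 < r → 0 < W r) (hmono : MonotoneOn W (Ioi 0))
    (hlow : ∀ r R, 0 < r → r ≤ R → B * (R / r) ^ γ * W r ≤ W R)
    (hK : 0 ≤ K) (hq : ∀ r, 0 < r → q r ≤ K / W r) (hqa : ∀ r, 0 < r → r ≤ a → q r ≤ K / W a)
    (hν : ∀ r, 0 < r → ν (Ioc 0 r) ≤ ENNReal.ofReal (C * (r * u))) :
    ∫⁻ s in Ioi 0, ENNReal.ofReal (q s) ∂ν ≤
      ENNReal.ofReal ((K * C + 2 * K * C / B * (1 - (2 : ℝ) ^ (1 - γ))⁻¹) * (a * u / W a)) := by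
  have hWa := hW _ ha
  -- Ratio of the block bounds as the scale doubles; it is below `1` because `γ > 1`.
  set y : ℝ := (2 : ℝ) ^ (1 - γ) with hy
  have hy0 : 0 < y := by positivity
  have hy1 : y < 1 := Real.rpow_lt_one_of_one_lt_of_neg (by norm_num) (by linarith)
  have hsub : Ioi (0 : ℝ) ⊆ Ioc 0 a ∪ ⋃ k : ℕ, Icc (2 ^ k * a) (2 * (2 ^ k * a)) := by
    intro s hs
    rcases le_or_gt s a with h | h
    · exact Or.inl ⟨hs, h⟩
    · exact Or.inr (Ioi_subset_iUnion_Icc_two_pow ha h)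
  have hblock : ∀ k : ℕ,
      ∫⁻ s in Icc (2 ^ k * a) (2 * (2 ^ k * a)), ENNReal.ofReal (q s) ∂ν
        ≤ ENNReal.ofReal (2 * K * C / B * (a * u / W a) * y ^ k) := by
    intro k
    set p : ℝ := 2 ^ k with hp
    have hp1 : 1 ≤ p := one_le_pow₀ (by norm_num)
    have hp0 : 0 < p := by positivity
    have hr : 0 < p * a := by positivity
    have hWr := hW _ hr
    refine (setLIntegral_Icc_le hW hmono hK hq hν hr).trans (ENNReal.ofReal_le_ofReal ?_)
    have h1 := hlow a (p * a) ha (le_mul_of_one_le_left ha.le hp1)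
    rw [mul_div_cancel_right₀ _ ha.ne'] at h1
    have hpγ : 0 < p ^ γ := by positivity
    have h2 : K / W (p * a) ≤ K / (B * p ^ γ * W a) := by gcongr
    have h3 : p / p ^ γ = y ^ k := by
      rw [← Real.rpow_one_sub' hp0.le (by linarith), hp, hy, ← Real.rpow_natCast,
        ← Real.rpow_natCast, ← Real.rpow_mul (by norm_num), ← Real.rpow_mul (by norm_num),
        mul_comm]
    calc K / W (p * a) * (C * (2 * (p * a) * u))
        ≤ K / (B * p ^ γ * W a) * (C * (2 * (p * a) * u)) := by gcongr
      _ = 2 * K * C / B * (a * u / W a) * (p / p ^ γ) := by field_simp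
      _ = _ := by rw [h3]
  have h1y : 0 < 1 - y := by linarith
  calc _ ≤ _ := lintegral_mono_set hsub
    _ ≤ _ := lintegral_union_le _ _ _
    _ ≤ ENNReal.ofReal (K / W a * (C * (a * u))) +
          ENNReal.ofReal (2 * K * C / B * (a * u / W a) * (1 - y)⁻¹) :=
        add_le_add (setLIntegral_Ioc_zero_le (by positivity) ha hqa hν)
          (setLIntegral_iUnion_le_of_geometric (by positivity) hy0.le hy1 hblock)
    _ = _ := by
        rw [← ENNReal.ofReal_add (by positivity) (by positivity)]
        congr 1
        ring

/-- Upper bound when `W` grows linearly: all dyadic scales between `a` and `1 / u` contribute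
equally. -/
theorem lintegral_le_of_linear (hu : 0 < u) (ha : 0 < a) (hau : a * u ≤ 1) (hC : 0 ≤ C)
    (hB : 0 ≤ B) (hW : ∀ r, 0 < r → 0 < W r) (hmono : MonotoneOn W (Ioi 0))
    (hup : ∀ r R, 0 < r → r ≤ R → W R ≤ B * (R / r) * W r)
    (hK : 0 ≤ K) (hq : ∀ r, 0 < r → q r ≤ K / W r) (hqa : ∀ r, 0 < r → r ≤ a → q r ≤ K / W a)
    (hν : ∀ r, 0 < r → ν (Ioc 0 r) ≤ ENNReal.ofReal (C * (r * u))) (hν1 : ν (Ioi 0) ≤ 1) :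
    ∫⁻ s in Ioi 0, ENNReal.ofReal (q s) ∂ν ≤
      ENNReal.ofReal ((3 * K * B * C + K) / Real.log 2 *
        (1 / W (1 / u) * Real.log (2 / (a * u)))) := by
  have hT : 0 < 1 / u := by positivity
  have hWT := hW _ hT
  have hWa := hW _ ha
  set T := 1 / u with hTdef
  have hTu : T * u = 1 := by rw [hTdef]; field_simp
  have haT : a ≤ T := by rw [hTdef, le_div_iff₀ hu]; exact hau
  have hau0 : 0 < a * u := by positivity
  -- For linear `W` the bound for a block is the same at every scale up to `T`.
  have key : ∀ r, 0 < r → r ≤ T → K / W r * (C * (r * u)) ≤ K * B * C / W T := by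
    intro r hr hrT
    have hWr := hW r hr
    have h1 := hup r T hr hrT
    have h2 : K / W r ≤ K * (B * (T / r)) / W T := by
      rw [div_le_div_iff₀ hWr hWT]
      calc K * W T ≤ K * (B * (T / r) * W r) := by gcongr
        _ = _ := by ring
    calc _ ≤ K * (B * (T / r)) / W T * (C * (r * u)) := by gcongr
      _ = K * B * C / W T * (T * u) := by field_simp
      _ = _ := by rw [hTu, mul_one]
  set ℓ := Real.log (2 / (a * u)) with hℓ
  have hl2 : 0 < Real.log 2 := Real.log_pos (by norm_num)
  have hlog : Real.log (1 / (a * u)) = ℓ - Real.log 2 := by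
    rw [hℓ, Real.log_div (by norm_num) hau0.ne', Real.log_div (by norm_num) hau0.ne',
      Real.log_one]; ring
  have hlog0 : 0 ≤ Real.log (1 / (a * u)) := Real.log_nonneg ((one_le_div hau0).2 hau)
  -- The number of `k ≥ 0` with `2^k a ≤ T`. The `2` inside `ℓ` pays for the `+ 1`, and also gives
  -- `ℓ / log 2 ≥ 1`, which absorbs the two end pieces even when `a u = 1`.
  set N : ℕ := ⌊Real.log (1 / (a * u)) / Real.log 2⌋₊ + 1 with hN
  have hNle : (N : ℝ) ≤ ℓ / Real.log 2 := by
    have := Nat.floor_le (div_nonneg hlog0 hl2.le)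
    rw [hlog, sub_div, div_self hl2.ne'] at this
    rw [hN, hlog, sub_div, div_self hl2.ne']
    push_cast
    linarith
  have hkN : ∀ k : ℕ, 2 ^ k * a ≤ T → k < N := by
    intro k hk
    rw [hN, Nat.lt_succ_iff]
    apply Nat.le_floor
    rw [le_div_iff₀ hl2, ← Real.log_pow]
    apply Real.log_le_log (by positivity)
    rw [le_div_iff₀ hau0, ← mul_assoc, ← hTu]
    gcongr
  have hsub : Ioi (0 : ℝ) ⊆
      (Ioc 0 a ∪ ⋃ k ∈ {k : ℕ | 2 ^ k * a ≤ T}, Icc (2 ^ k * a) (2 * (2 ^ k * a))) ∪ Ioi T := by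
    intro s hs
    rcases le_or_gt s a with h | h
    · exact Or.inl (Or.inl ⟨hs, h⟩)
    · rcases le_or_gt s T with h' | h'
      · obtain ⟨k, hk⟩ := mem_iUnion.1 (Ioi_subset_iUnion_Icc_two_pow ha h)
        exact Or.inl (Or.inr (mem_biUnion (show 2 ^ k * a ≤ T from hk.1.trans h') hk))
      · exact Or.inr h'
  have hblocks : ∫⁻ s in ⋃ k ∈ {k : ℕ | 2 ^ k * a ≤ T}, Icc (2 ^ k * a) (2 * (2 ^ k * a)),
      ENNReal.ofReal (q s) ∂ν ≤ ENNReal.ofReal (N * (2 * (K * B * C / W T))) := by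
    have hsub' : (⋃ k ∈ {k : ℕ | 2 ^ k * a ≤ T}, Icc (2 ^ k * a) (2 * (2 ^ k * a))) ⊆
        ⋃ k ∈ (Finset.range N).filter (fun k : ℕ => 2 ^ k * a ≤ T),
          Icc (2 ^ k * a) (2 * (2 ^ k * a)) :=
      biUnion_subset_biUnion_left fun k hk => by
        simpa using ⟨hkN k hk, hk⟩
    calc _ ≤ _ := lintegral_mono_set hsub'
      _ ≤ ∑ k ∈ (Finset.range N).filter (fun k : ℕ => 2 ^ k * a ≤ T),
          ∫⁻ s in Icc (2 ^ k * a) (2 * (2 ^ k * a)), ENNReal.ofReal (q s) ∂ν :=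
        lintegral_biUnion_finset_le _ _ _
      _ ≤ ∑ k ∈ (Finset.range N).filter (fun k : ℕ => 2 ^ k * a ≤ T),
          ENNReal.ofReal (2 * (K * B * C / W T)) := by
        refine Finset.sum_le_sum fun k hk => ?_
        have hr : 0 < 2 ^ k * a := by positivity
        refine (setLIntegral_Icc_le hW hmono hK hq hν hr).trans (ENNReal.ofReal_le_ofReal ?_)
        have := key _ hr (Finset.mem_filter.1 hk).2
        linarith
      _ ≤ ∑ k ∈ Finset.range N, ENNReal.ofReal (2 * (K * B * C / W T)) :=
        Finset.sum_le_sum_of_subset (Finset.filter_subset _ _)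
      _ = _ := by
        rw [Finset.sum_const, Finset.card_range, nsmul_eq_mul,
          ENNReal.ofReal_mul (Nat.cast_nonneg N), ENNReal.ofReal_natCast]
  have h0 : ∫⁻ s in Ioc 0 a, ENNReal.ofReal (q s) ∂ν ≤ ENNReal.ofReal (K * B * C / W T) :=
    (setLIntegral_Ioc_zero_le (by positivity) ha hqa hν).trans
      (ENNReal.ofReal_le_ofReal (key a ha haT))
  calc _ ≤ _ := lintegral_mono_set hsub
    _ ≤ _ := lintegral_union_le _ _ _
    _ ≤ _ := add_le_add_left (lintegral_union_le _ _ _) _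
    _ ≤ ENNReal.ofReal (K * B * C / W T) + ENNReal.ofReal (N * (2 * (K * B * C / W T))) +
          ENNReal.ofReal (K / W T) :=
        add_le_add (add_le_add h0 hblocks) (setLIntegral_Ioi_le hu hW hmono hK hq hν1)
    _ = ENNReal.ofReal (K * B * C / W T + N * (2 * (K * B * C / W T)) + K / W T) := by
        rw [← ENNReal.ofReal_add (by positivity) (by positivity),
          ← ENNReal.ofReal_add (by positivity) (by positivity)]
    _ ≤ _ := by
        apply ENNReal.ofReal_le_ofReal
        have h1 : 1 ≤ ℓ / Real.log 2 := by
          rw [one_le_div hl2]; linarith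
        have h2 : 0 ≤ K * B * C / W T := by positivity
        have h3 : 0 ≤ K / W T := by positivity
        have h4 := mul_le_mul_of_nonneg_right hNle (show 0 ≤ 2 * (K * B * C / W T) by positivity)
        have h5 := mul_le_mul_of_nonneg_right h1 h2
        have h6 := mul_le_mul_of_nonneg_right h1 h3
        have e : (3 * K * B * C + K) / Real.log 2 * (1 / W T * ℓ) =
          ℓ / Real.log 2 * (K * B * C / W T) + ℓ / Real.log 2 * (2 * (K * B * C / W T)) +
            ℓ / Real.log 2 * (K / W T) := by ring
        rw [e]
        linarith

variable {L c : ℝ}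

/-- On `(r, L r]` monotonicity bounds the kernel below by `K / W(L r)`, and doubling returns this to
`W(r)`. -/
theorem ofReal_le_setLIntegral_Ioc (hW : ∀ r, 0 < r → 0 < W r) (hmono : MonotoneOn W (Ioi 0))
    (hL : 1 < L) (hK : 0 ≤ K) (ha : 0 < a) (hu : 0 < u) (hc : 0 ≤ c)
    (hup : ∀ r, 0 < r → W (L * r) ≤ B * W r)
    (hq : ∀ r, a ≤ r → K / W r ≤ q r)
    (hν : ∀ r, 0 < r → r * u ≤ 1 → ENNReal.ofReal (c * (r * u)) ≤ ν (Ioc r (L * r)))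
    {r : ℝ} (har : a ≤ r) (hr1 : r * u ≤ 1) :
    ENNReal.ofReal (K * c / B * (r * u / W r)) ≤
      ∫⁻ s in Ioc r (L * r), ENNReal.ofReal (q s) ∂ν := by
  have hr : 0 < r := ha.trans_le har
  have hWr := hW r hr
  have hLr : 0 < L * r := by positivity
  have hWL := hW _ hLr
  refine le_trans (ENNReal.ofReal_le_ofReal ?_) (ofReal_mul_le_setLIntegral (A := K / W (L * r))
    measurableSet_Ioc (by positivity) (fun s hs => ?_) (hν r hr hr1))
  · have h1 := hup r hr
    calc K * c / B * (r * u / W r) = K / (B * W r) * (c * (r * u)) := by ring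
      _ ≤ K / W (L * r) * (c * (r * u)) := by gcongr
  · have hs0 : 0 < s := hr.trans hs.1
    have h1 := hmono hs0 hLr hs.2
    have h2 := hW s hs0
    exact le_trans (by gcongr) (hq s (har.trans hs.1.le))

/-- Lower bound from the single scale `r`. -/
theorem ofReal_le_lintegral (hW : ∀ r, 0 < r → 0 < W r) (hmono : MonotoneOn W (Ioi 0))
    (hL : 1 < L) (hK : 0 ≤ K) (ha : 0 < a) (hu : 0 < u) (hc : 0 ≤ c)
    (hup : ∀ r, 0 < r → W (L * r) ≤ B * W r)
    (hq : ∀ r, a ≤ r → K / W r ≤ q r)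
    (hν : ∀ r, 0 < r → r * u ≤ 1 → ENNReal.ofReal (c * (r * u)) ≤ ν (Ioc r (L * r)))
    (ha1 : a * u ≤ 1) :
    ENNReal.ofReal (K * c / B * (a * u / W a)) ≤ ∫⁻ s in Ioi 0, ENNReal.ofReal (q s) ∂ν :=
  (ofReal_le_setLIntegral_Ioc hW hmono hL hK ha hu hc hup hq hν le_rfl ha1).trans
    (lintegral_mono_set fun _ hs => ha.trans hs.1)

/-- Lower bound from all the scales between `a` and `1 / u`, when `W` grows linearly. -/
theorem ofReal_log_le_lintegral {b : ℝ} (hW : ∀ r, 0 < r → 0 < W r)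
    (hmono : MonotoneOn W (Ioi 0)) (hL : 1 < L) (hK : 0 ≤ K) (ha : 0 < a) (hu : 0 < u) (hB : 0 < B)
    (hc : 0 ≤ c) (hb : 0 < b) (hup : ∀ r, 0 < r → W (L * r) ≤ B * W r)
    (hlow : ∀ r R, 0 < r → r ≤ R → b * (R / r) * W r ≤ W R)
    (hq : ∀ r, a ≤ r → K / W r ≤ q r)
    (hν : ∀ r, 0 < r → r * u ≤ 1 → ENNReal.ofReal (c * (r * u)) ≤ ν (Ioc r (L * r)))
    (ha1 : a * u ≤ 1) :
    ENNReal.ofReal (K * c * b / B / (Real.log 2 + Real.log L) *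
        (1 / W (1 / u) * Real.log (2 / (a * u)))) ≤
      ∫⁻ s in Ioi 0, ENNReal.ofReal (q s) ∂ν := by
  have hT : 0 < 1 / u := by positivity
  have hWT := hW _ hT
  set T := 1 / u with hTdef
  have hTu : T * u = 1 := by rw [hTdef]; field_simp
  have hau0 : 0 < a * u := by positivity
  have hl2 : 0 < Real.log 2 := Real.log_pos (by norm_num)
  have hlL : 0 < Real.log L := Real.log_pos hL
  have hL0 : 0 < L := by linarith
  set ℓ := Real.log (2 / (a * u)) with hℓ
  have hlog : Real.log (1 / (a * u)) = ℓ - Real.log 2 := by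
    rw [hℓ, Real.log_div (by norm_num) hau0.ne', Real.log_div (by norm_num) hau0.ne',
      Real.log_one]; ring
  have hlog0 : 0 ≤ Real.log (1 / (a * u)) := Real.log_nonneg ((one_le_div hau0).2 ha1)
  set N : ℕ := ⌊Real.log (1 / (a * u)) / Real.log L⌋₊ + 1 with hN
  -- Add `N log L ≥ ℓ - log 2`, from the floor, to `N log 2 ≥ log 2`, from `N ≥ 1`.
  have hNge : ℓ / (Real.log 2 + Real.log L) ≤ N := by
    have h1 := Nat.lt_floor_add_one (Real.log (1 / (a * u)) / Real.log L)
    have h2 : (N : ℝ) = ⌊Real.log (1 / (a * u)) / Real.log L⌋₊ + 1 := by rw [hN]; push_cast; rfl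
    rw [← h2, div_lt_iff₀ hlL] at h1
    have h3 : (1 : ℝ) ≤ N := by
      rw [h2]
      linarith [Nat.cast_nonneg (α := ℝ) (⌊Real.log (1 / (a * u)) / Real.log L⌋₊)]
    rw [div_le_iff₀ (by positivity)]
    nlinarith
  have hmon : Monotone fun k : ℕ => L ^ k * a := fun i j hij => by
    have : L ^ i ≤ L ^ j := pow_le_pow_right₀ hL.le hij
    change L ^ i * a ≤ L ^ j * a
    gcongr
  -- Contributions from below may be added only over disjoint blocks, hence consecutive half-open
  -- intervals with ratio `L`.
  have hdisj := hmon.pairwise_disjoint_on_Ioc_succ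
  have hblock : ∀ k ∈ Finset.range N, ENNReal.ofReal (K * c * b / B / W T) ≤
      ∫⁻ s in Ioc (L ^ k * a) (L ^ (k + 1) * a), ENNReal.ofReal (q s) ∂ν := by
    intro k hk
    have hr : 0 < L ^ k * a := by positivity
    have har : a ≤ L ^ k * a := le_mul_of_one_le_left ha.le (one_le_pow₀ hL.le)
    have hr1 : L ^ k * a * u ≤ 1 := by
      have h1 : (k : ℝ) ≤ Real.log (1 / (a * u)) / Real.log L :=
        (Nat.le_floor_iff (by positivity)).1 (Nat.lt_succ_iff.1 (Finset.mem_range.1 hk))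
      rw [le_div_iff₀ hlL, ← Real.log_pow,
        Real.log_le_log_iff (by positivity) (by positivity), le_div_iff₀ hau0] at h1
      linarith
    have h1 := ofReal_le_setLIntegral_Ioc hW hmono hL hK ha hu hc hup hq hν har hr1
    rw [show L ^ (k + 1) * a = L * (L ^ k * a) by ring]
    refine le_trans (ENNReal.ofReal_le_ofReal ?_) h1
    set r := L ^ k * a
    have hWr := hW r hr
    have h2 := hlow r T hr (by rw [hTdef, le_div_iff₀ hu]; exact hr1)
    have h3 : b / W T ≤ r * u / W r := by
      rw [div_le_div_iff₀ hWT hWr]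
      calc b * W r = b * (T / r) * W r * (r * u) := by
            rw [hTdef]; field_simp
        _ ≤ W T * (r * u) := by gcongr
        _ = _ := mul_comm _ _
    calc _ = K * c / B * (b / W T) := by ring
      _ ≤ _ := by gcongr
  calc _ ≤ ENNReal.ofReal (N * (K * c * b / B / W T)) := by
        apply ENNReal.ofReal_le_ofReal
        have h2 : 0 ≤ K * c * b / B / W T := by positivity
        calc _ = ℓ / (Real.log 2 + Real.log L) * (K * c * b / B / W T) := by ring
          _ ≤ _ := by gcongr
    _ = ∑ k ∈ Finset.range N, ENNReal.ofReal (K * c * b / B / W T) := by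
        rw [Finset.sum_const, Finset.card_range, nsmul_eq_mul,
          ENNReal.ofReal_mul (Nat.cast_nonneg N), ENNReal.ofReal_natCast]
    _ ≤ ∑ k ∈ Finset.range N,
          ∫⁻ s in Ioc (L ^ k * a) (L ^ (k + 1) * a), ENNReal.ofReal (q s) ∂ν :=
        Finset.sum_le_sum hblock
    _ = ∫⁻ s in ⋃ k ∈ Finset.range N, Ioc (L ^ k * a) (L ^ (k + 1) * a),
          ENNReal.ofReal (q s) ∂ν :=
        (lintegral_biUnion_finset (fun i _ j _ hij => hdisj hij)
          (fun _ _ => measurableSet_Ioc) _).symm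
    _ ≤ _ := lintegral_mono_set (iUnion₂_subset fun k _ s hs =>
        (show (0 : ℝ) < L ^ k * a by positivity).trans hs.1)

end Integrals

/-! ### Divergence on the diagonal and conclusion. -/

theorem eq_top_of_tendsto_atTop {p : ℝ≥0∞} {g : ℝ → ℝ} {A : ℝ} (hA : 0 < A)
    (hg : Filter.Tendsto g (nhdsWithin 0 (Ioi 0)) Filter.atTop)
    (h : ∀ᶠ a in nhdsWithin 0 (Ioi 0), ENNReal.ofReal (A * g a) ≤ p) : p = ∞ :=
  top_le_iff.1 (le_of_tendsto
    (ENNReal.tendsto_ofReal_atTop.comp (hg.const_mul_atTop hA)) h)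

theorem eventually_mul_le_one {u : ℝ} (hu : 0 < u) :
    ∀ᶠ a in nhdsWithin (0 : ℝ) (Ioi 0), 0 < a ∧ a * u ≤ 1 := by
  filter_upwards [Ioc_mem_nhdsGT (show (0 : ℝ) < 1 / u by positivity)] with a ha
  exact ⟨ha.1, (le_div_iff₀ hu).1 ha.2⟩

end TimeFractional

open TimeFractional in
theorem corollary5p3
    {M : Type*} [MetricSpace M] [LocallyCompactSpace M] [TopologicalSpace.SeparableSpace M]
    [MeasurableSpace M] [BorelSpace M]
    (μ : Measure M) [μ.Regular] [μ.IsOpenPosMeasure]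
    -- volume scaling
    (d₁ d₂ : ℝ) (hV : TimeFractional.WeakScalingUniformly (TimeFractional.vol μ) d₁ d₂)
    -- the subordinator and its Laplace exponent
    {Ω : Type*} [MeasurableSpace Ω] (P : Measure Ω) [IsProbabilityMeasure P]
    (S : ℝ≥0 → Ω → ℝ) (hS : TimeFractional.IsSubordinator P S)
    (φ : ℝ → ℝ) (hφ : TimeFractional.IsDriftlessLaplaceExponent P S φ)
    (β₁ β₂ : ℝ) (hβ₂ : β₂ < 1) (hφs : TimeFractional.WeakScaling φ β₁ β₂)
    -- the strong Markov process and its heat kernel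
    {Ω' : Type*} {mΩ' : MeasurableSpace Ω'} (ℱ : Filtration ℝ≥0 mΩ') (Q : M → Measure Ω')
    (X : ℝ≥0 → Ω' → M) (hX : TimeFractional.IsStrongMarkovProcess ℱ Q X)
    (q : ℝ → M → M → ℝ) (hq : TimeFractional.IsHeatKernel μ Q X q)
    -- the scale function
    (Φ : ℝ → ℝ) (hΦ : StrictMonoOn Φ (Ici 0)) (hΦ0 : Φ 0 = 0)
    (α₁ α₂ : ℝ) (hΦs : TimeFractional.WeakScaling Φ α₁ α₂)
    (hest : TimeFractional.JumpEstimate μ Φ q ∨ TimeFractional.DiffusionCase μ Q X Φ α₁ q) :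
    (d₂ < α₁ →
      TimeFractional.Comparable
        (fun t x y => 0 < t ∧ Φ (dist x y) * φ t⁻¹ ≤ 1)
        (TimeFractional.fundamentalSolution hS q)
        (fun t x _ => 1 / TimeFractional.vol μ x (TimeFractional.inv Φ (1 / φ t⁻¹)))) ∧
    (α₂ < d₁ →
      TimeFractional.Comparable
        (fun t x y => 0 < t ∧ x ≠ y ∧ Φ (dist x y) * φ t⁻¹ ≤ 1)
        (TimeFractional.fundamentalSolution hS q)
        (fun t x y => Φ (dist x y) * φ t⁻¹ / TimeFractional.vol μ x (dist x y)) ∧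
      ∀ (t : ℝ) (x : M), 0 < t → TimeFractional.fundamentalSolution hS q t x x = ∞) ∧
    (d₁ = d₂ → d₂ = α₁ → α₁ = α₂ →
      TimeFractional.Comparable
        (fun t x y => 0 < t ∧ x ≠ y ∧ Φ (dist x y) * φ t⁻¹ ≤ 1)
        (TimeFractional.fundamentalSolution hS q)
        (fun t x y => 1 / TimeFractional.vol μ x (TimeFractional.inv Φ (1 / φ t⁻¹)) *
          Real.log (2 / (Φ (dist x y) * φ t⁻¹))) ∧
      ∀ (t : ℝ) (x : M), 0 < t → TimeFractional.fundamentalSolution hS q t x x = ∞) := by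

  have hvol := hV.comp (hΦs.inv hΦ0)
  have hα₁ := hΦs.pos_left
  have hα₂ : 0 < α₂ := hα₁.trans_le hΦs.left_le_right
  obtain ⟨c, K, hc, hK, hker⟩ :
      ∃ c C : ℝ, 0 < c ∧ 0 < C ∧ KernelBounds μ Φ q c C := by
    rcases hest with h | h
    · exact h.exists_kernelBounds hV hΦs hΦ
    · exact h.estimate.exists_kernelBounds hV hΦs hΦ hΦ0 h.one_lt
  obtain ⟨L, m, hL, hm, hν⟩ := exists_le_stieltjes_tail_Ioc hS hφ hφs hβ₂
  -- An opaque `W` expresses everything through one function per `x`; `V(x, d)` becomes `W x (Φ d)`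
  -- because `inv Φ` inverts `Φ` exactly on its range.
  obtain ⟨W, hWdef⟩ : ∃ W : M → ℝ → ℝ, ∀ x r, vol μ x (inv Φ r) = W x r :=
    ⟨_, fun _ _ => rfl⟩
  have hWd : ∀ x y : M, vol μ x (dist x y) = W x (Φ (dist x y)) := fun x y => by
    rw [← hWdef, inv_apply hΦ dist_nonneg]
  simp only [hWdef, hWd] at hvol ⊢
  obtain ⟨b₁, b₂, hb₁, hb₂, hb⟩ := hvol.scaling
  have hL0 : 0 < L := by linarith
  have hW : ∀ x r, 0 < r → 0 < W x r := hvol.pos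
  have hmono : ∀ x, MonotoneOn (W x) (Ioi 0) := hvol.mono
  have hup : ∀ x r R, 0 < r → r ≤ R → W x R ≤ b₂ * (R / r) ^ (α₁⁻¹ * d₂) * W x r :=
    fun x r R hr hR => (div_le_iff₀ (hW x r hr)).1 (hb x r R hr hR).2
  have hlow : ∀ x r R, 0 < r → r ≤ R → b₁ * (R / r) ^ (α₂⁻¹ * d₁) * W x r ≤ W x R :=
    fun x r R hr hR => (le_div_iff₀ (hW x r hr)).1 (hb x r R hr hR).1
  obtain ⟨B, hB, hupL⟩ : ∃ B : ℝ, 0 < B ∧ ∀ x r, 0 < r → W x (L * r) ≤ B * W x r := by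
    refine ⟨b₂ * L ^ (α₁⁻¹ * d₂), by positivity, fun x r hr => ?_⟩
    have := hup x r (L * r) hr (le_mul_of_one_le_left hr.le hL.le)
    rwa [mul_div_cancel_right₀ _ hr.ne'] at this
  have hu : ∀ t : ℝ, 0 < t → 0 < φ t⁻¹ := fun t ht => hφs.pos (_root_.inv_pos.2 ht)
  obtain ⟨C, hC, hνup⟩ : ∃ C : ℝ, 0 < C ∧ ∀ t, 0 < t → ∀ r, 0 < r →
      (hS.monotone_tail t).stieltjesFunction.measure (Ioc 0 r) ≤
        ENNReal.ofReal (C * (r * φ t⁻¹)) := by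
    have h1 : Real.exp (-1) < 1 := Real.exp_lt_one_iff.2 (by norm_num)
    have h2 : 0 < 1 - Real.exp (-1) := by linarith
    exact ⟨2 * (1 - Real.exp (-1))⁻¹, by positivity,
      fun t ht r hr => stieltjes_tail_Ioc_le hS hφ ht hr⟩
  have hνlow : ∀ t, 0 < t → ∀ r, 0 < r → r * φ t⁻¹ ≤ 1 → ENNReal.ofReal (m * (r * φ t⁻¹)) ≤
      (hS.monotone_tail t).stieltjesFunction.measure (Ioc r (L * r)) :=
    fun t ht r hr h1 => hν t r ht hr h1
  have hΦd : ∀ x y : M, x ≠ y → 0 < Φ (dist x y) := fun x y hxy => hΦs.pos (dist_pos.2 hxy)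
  have hqu : ∀ x y : M, ∀ r, 0 < r → q r x y ≤ K / W x r := fun x y r hr => by
    rw [← hWdef]; exact hker.upper r x y hr
  have hqa : ∀ x y : M, x ≠ y → ∀ r, 0 < r → r ≤ Φ (dist x y) →
      q r x y ≤ K / W x (Φ (dist x y)) := fun x y hxy r hr h => by
    rw [← hWd]; exact hker.upper_off_diag r x y hr hxy h
  have hqlow : ∀ x y : M, ∀ a, 0 < a → Φ (dist x y) ≤ a → ∀ r, a ≤ r → c / W x r ≤ q r x y :=
    fun x y a ha h r hr => by
    rw [← hWdef]; exact hker.lower r x y (ha.trans_le hr) (h.trans hr)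
  -- The scale `a ≥ Φ(d(x,y))` is left free: it is `1 / φ(1/t)` in the first case, `Φ(d(x,y))` in
  -- the second, and tends to `0` on the diagonal.
  have single : ∀ t x y a, 0 < t → 0 < a → Φ (dist x y) ≤ a → a * φ t⁻¹ ≤ 1 →
      ENNReal.ofReal (c * m / B * (a * φ t⁻¹ / W x a)) ≤ fundamentalSolution hS q t x y :=
    fun t x y a ht ha h h1 => ofReal_le_lintegral (hW x) (hmono x) hL hc.le ha (hu t ht) hm.le
      (hupL x) (hqlow x y a ha h) (hνlow t ht) h1
  refine ⟨fun h => ?_, fun h => ⟨?_, fun t x ht => ?_⟩, fun h1 h2 h3 => ?_⟩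
  · have hγ : α₁⁻¹ * d₂ < 1 := by rwa [inv_mul_lt_iff₀ hα₁, mul_one]
    have hy1 : (1 / 2 : ℝ) ^ (1 - α₁⁻¹ * d₂) < 1 :=
      Real.rpow_lt_one (by norm_num) (by norm_num) (by linarith)
    have hy2 : 0 < 1 - (1 / 2 : ℝ) ^ (1 - α₁⁻¹ * d₂) := by linarith
    refine ⟨c * m / B, 2 * K * b₂ * C * (1 - (1 / 2 : ℝ) ^ (1 - α₁⁻¹ * d₂))⁻¹ + K,
      by positivity, by positivity, fun t x y hD => ?_⟩
    obtain ⟨ht, hD⟩ := hD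
    have hut := hu t ht
    constructor
    · have h1 := single t x y (1 / φ t⁻¹) ht (by positivity) ((le_div_iff₀ hut).2 hD)
        (by rw [one_div_mul_cancel hut.ne'])
      rwa [one_div_mul_cancel hut.ne'] at h1
    · rw [mul_one_div]
      exact lintegral_le_of_sublinear hut hC.le hb₂.le hγ (hW x) (hmono x) (hup x) hK.le
        (hqu x y) (hνup t ht) (stieltjes_tail_Ioi_le hS t)
  · have hγ : 1 < α₂⁻¹ * d₁ := by rwa [lt_inv_mul_iff₀ hα₂, mul_one]
    have hy1 : (2 : ℝ) ^ (1 - α₂⁻¹ * d₁) < 1 :=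
      Real.rpow_lt_one_of_one_lt_of_neg (by norm_num) (by linarith)
    have hy2 : 0 < 1 - (2 : ℝ) ^ (1 - α₂⁻¹ * d₁) := by linarith
    refine ⟨c * m / B, K * C + 2 * K * C / b₁ * (1 - (2 : ℝ) ^ (1 - α₂⁻¹ * d₁))⁻¹,
      by positivity, by positivity, fun t x y hD => ?_⟩
    obtain ⟨ht, hxy, hD⟩ := hD
    have hut := hu t ht
    exact ⟨single t x y _ ht (hΦd x y hxy) le_rfl hD,
      lintegral_le_of_superlinear hut (hΦd x y hxy) hC.le hb₁ hγ (hW x) (hmono x) (hlow x) hK.le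
        (hqu x y) (hqa x y hxy) (hνup t ht)⟩
  · have hγ : 1 < α₂⁻¹ * d₁ := by rwa [lt_inv_mul_iff₀ hα₂, mul_one]
    have hut := hu t ht
    have hT : 0 < 1 / φ t⁻¹ := by positivity
    have hWT := hW x _ hT
    -- With `γ = d₁/α₂ > 1` and `u = φ(1/t)`, lower scaling between `a` and `1/u` gives `a u / W(a)
    -- ≥ (b₁ / W(1/u)) (a u)^(1 - γ)`, which blows up as `a → 0`.
    set A : ℝ := c * m / B * (b₁ / W x (1 / φ t⁻¹)) with hA
    refine eq_top_of_tendsto_atTop (A := A) (by positivity)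
      (g := fun a => (a * φ t⁻¹) ^ (1 - α₂⁻¹ * d₁)) ?_ ?_
    · refine (tendsto_rpow_neg_nhdsGT_zero (by linarith)).comp ?_
      refine tendsto_nhdsWithin_iff.2 ⟨?_, ?_⟩
      · have : Filter.Tendsto (fun a : ℝ => a * φ t⁻¹) (nhds 0) (nhds (0 * φ t⁻¹)) :=
          (continuous_id.mul continuous_const).tendsto 0
        rw [zero_mul] at this
        exact this.mono_left nhdsWithin_le_nhds
      · filter_upwards [self_mem_nhdsWithin] with a ha
        exact mul_pos ha hut
    · filter_upwards [eventually_mul_le_one hut] with a ha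
      obtain ⟨ha, ha1⟩ := ha
      refine le_trans (ENNReal.ofReal_le_ofReal ?_)
        (single t x x a ht ha (by rw [dist_self, hΦ0]; exact ha.le) ha1)
      have hWa := hW x a ha
      have hau : 0 < a * φ t⁻¹ := by positivity
      have h2 := hlow x a (1 / φ t⁻¹) ha ((le_div_iff₀ hut).2 ha1)
      rw [div_div, mul_comm (φ t⁻¹) a, one_div (a * _), Real.inv_rpow hau.le] at h2
      have hp : 0 < (a * φ t⁻¹) ^ (α₂⁻¹ * d₁) := by positivity
      rw [hA, mul_assoc]
      refine mul_le_mul_of_nonneg_left ?_ (by positivity)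
      rw [Real.rpow_sub hau, Real.rpow_one, div_mul_eq_mul_div, div_le_div_iff₀ hWT hWa]
      calc _ = (b₁ * ((a * φ t⁻¹) ^ (α₂⁻¹ * d₁))⁻¹ * W x a) * (a * φ t⁻¹) := by ring
        _ ≤ W x (1 / φ t⁻¹) * (a * φ t⁻¹) := by gcongr
        _ = _ := mul_comm _ _
  -- Both exponents of `W` equal `1`, so `W` is linear up to constants in both directions.
  · have e1 : α₁⁻¹ * d₂ = 1 := by rw [h2, inv_mul_cancel₀ hα₁.ne']
    have e2 : α₂⁻¹ * d₁ = 1 := by rw [h1, h2, h3, inv_mul_cancel₀ hα₂.ne']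
    simp only [e1, Real.rpow_one] at hup
    simp only [e2, Real.rpow_one] at hlow
    have hl2 : 0 < Real.log 2 := Real.log_pos (by norm_num)
    have hlL : 0 < Real.log L := Real.log_pos hL
    have logLower : ∀ t x y a, 0 < t → 0 < a → Φ (dist x y) ≤ a → a * φ t⁻¹ ≤ 1 →
        ENNReal.ofReal (c * m * b₁ / B / (Real.log 2 + Real.log L) *
          (1 / W x (1 / φ t⁻¹) * Real.log (2 / (a * φ t⁻¹)))) ≤
            fundamentalSolution hS q t x y :=
      fun t x y a ht ha h h1 => ofReal_log_le_lintegral (hW x) (hmono x) hL hc.le ha (hu t ht) hB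
        hm.le hb₁ (hupL x) (hlow x) (hqlow x y a ha h) (hνlow t ht) h1
    refine ⟨⟨c * m * b₁ / B / (Real.log 2 + Real.log L), (3 * K * b₂ * C + K) / Real.log 2,
      by positivity, by positivity, fun t x y hD => ?_⟩, fun t x ht => ?_⟩
    · obtain ⟨ht, hxy, hD⟩ := hD
      exact ⟨logLower t x y _ ht (hΦd x y hxy) le_rfl hD,
        lintegral_le_of_linear (hu t ht) (hΦd x y hxy) hD hC.le hb₂.le (hW x) (hmono x) (hup x) hK.le
          (hqu x y) (hqa x y hxy) (hνup t ht)
          (stieltjes_tail_Ioi_le hS t)⟩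
    · have hut := hu t ht
      have hWT := hW x (1 / φ t⁻¹) (by positivity)
      refine eq_top_of_tendsto_atTop
        (A := c * m * b₁ / B / (Real.log 2 + Real.log L) * (1 / W x (1 / φ t⁻¹)))
        (by positivity) (g := fun a => Real.log (2 / (a * φ t⁻¹))) ?_ ?_
      · refine Real.tendsto_log_atTop.comp ?_
        have : Filter.Tendsto (fun a : ℝ => 2 / φ t⁻¹ * a⁻¹) (nhdsWithin 0 (Ioi 0))
            Filter.atTop := tendsto_inv_nhdsGT_zero.const_mul_atTop (by positivity)
        refine this.congr fun a => ?_
        rw [← div_eq_mul_inv, div_div, mul_comm]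
      · filter_upwards [eventually_mul_le_one hut] with a ha
        rw [mul_assoc]
        exact logLower t x x a ht ha.1 (by rw [dist_self, hΦ0]; exact ha.1.le) ha.2
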